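/- **Setting.** An environment is a family $\omega=(\omega_{xy})_{x,y\in\mathbb Z}$ of nonnegative numbers with $\sum_{y}\omega_{xy}=1$ for every $x\in\mathbb Z$; the set $\Omega$ of environments carries the product $\sigma$-algebra. For $x_0\in\mathbb Z$, let $\mathtt P^{x_0}_\omega$ denote the (quenched) law of the Markov chain $(S_n)_{n\ge 0}$ on $\mathbb Z$ with $S_0=x_0$ and $\mathtt P^{x_0}_\omega[S_{n+1}=x+y\mid S_n=x]=\omega_{xy}$; write $\mathtt P_\omega=\mathtt P^0_\omega$. For an integer $\varrho>1$ the truncated environment $\omega^\varrho$ is given by $\omega^\varrho_{xy}=\omega_{xy}$ if $0<|y|<\varrho$, $\omega^\varrho_{xy}=0$ if $|y|\ge\varrho$, and $\omega^\varrho_{x0}=\omega_{x0}+\sum_{|y|\ge\varrho}\omega_{xy}$; moreover $\omega^\infty=\omega$. Let $S^\varrho$ be the Markov chain in the environment $\omega^\varrho$ started from $0$ (so that $S^\infty=S$), considered under its quenched law, still written $\mathtt P_\omega$, with expectation $\mathtt E_\omega$; let $N^\varrho_\infty(x)=\sum_{k\ge 0}\mathbf 1\{S^\varrho_k=x\}$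 be the total number of its visits to $x$. Let $\mathbb P$ be a probability measure on $\Omega$ under which the sequence $(\omega_{x\,\cdot})_{x\in\mathbb Z}$ is stationary and ergodic, and suppose that the following conditions hold. - **Condition E.** There is $\tilde\varepsilon>0$ such that $\mathbb P[\omega_{01}\ge\tilde\varepsilon]=1$. - **Condition C.** There are $\gamma_1>0$ and $\alpha>1$ such that for all real $s\ge 1$, $\sum_{y:|y|\ge s}\omega_{0y}\le\gamma_1 s^{-\alpha}$, $\mathbb P$-a.s. - **Condition D.** There are a non-increasing function $g_1:\{0,1,2,\dots\}\to[0,\infty)$ with $\sum_{k\ge1}k\,g_1(k)<\infty$ and an integer $\varrho_0>1$ such that for all integers $x\le 0$ and all integers $\varrho\ge\varrho_0$, $\mathtt E_\omega N^\varrho_\infty(x)\le g_1(|x|)$, $\mathbb P$-a.s. **Theorem 2.2.** For every $\varrho\in\{\varrho_0,\varrho_0+1,\dots\}\cup\{\infty\}$ there exists a deterministic $v_\varrho>0$ such that for $\mathbb P$-almost every $\omega$, $$\frac{S^\varrho_n}{n}\to v_\varrho\quad\text{as }n\to\infty,\qquad \mathtt P_\omega\text{-a.s.}$$ -/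

import Mathlib

open MeasureTheory ProbabilityTheory Filter Topology
open scoped NNReal ENNReal

namespace RWRE

/-- The space of environments: `ω x y` is the probability that the walk standing at `x` makes the
jump `y`, i.e. moves to `x + y`. The sigma-algebra is the one inherited from the product. -/
abbrev Environment : Type := {ω : ℤ → ℤ → ℝ≥0 // ∀ x, HasSum (ω x) 1}

/-- The spatial shift `(θ_z ω)_{xy} = ω_{x+z,y}`. -/
def shift (z : ℤ) (ω : Environment) : Environment :=
  ⟨fun x y => ω.1 (x + z) y, fun x => ω.2 (x + z)⟩

/-- The transition probabilities of the truncated environment: jumps of length less than `ϱ` are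
kept, and the mass of the jumps of length at least `ϱ` is moved to the jump `0`. The clause
`z ≠ 0` is redundant as soon as `ϱ ≥ 1`; it only makes the definition meaningful for `ϱ = 0`. -/
noncomputable def truncFun (ϱ : ℕ∞) (ω : Environment) (x y : ℤ) : ℝ≥0 :=
  if y = 0 then ω.1 x 0 + ∑' z : {z : ℤ // z ≠ 0 ∧ ϱ ≤ (z.natAbs : ℕ∞)}, ω.1 x z
  else if (y.natAbs : ℕ∞) < ϱ then ω.1 x y
  else 0

theorem hasSum_truncFun (ϱ : ℕ∞) (ω : Environment) (x : ℤ) :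
    HasSum (truncFun ϱ ω x) 1 := by
  classical
  have hs : Summable (ω.1 x) := (ω.2 x).summable
  let F : Set ℤ := {z : ℤ | z ≠ 0 ∧ ϱ ≤ (z.natAbs : ℕ∞)}
  have hF : HasSum (F.indicator (ω.1 x)) (∑' z : F, ω.1 x z) := by
    rw [tsum_subtype]
    exact (NNReal.summable_of_le (fun z => Set.indicator_le_self' (fun _ _ => zero_le) z) hs).hasSum
  have hN : HasSum (Fᶜ.indicator (ω.1 x)) (∑' z, Fᶜ.indicator (ω.1 x) z) :=
    (NNReal.summable_of_le (fun z => Set.indicator_le_self' (fun _ _ => zero_le) z) hs).hasSum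
  have h1 : (∑' z, Fᶜ.indicator (ω.1 x) z) + ∑' z : F, ω.1 x z = 1 := by
    refine (hN.add hF).unique ?_
    convert ω.2 x using 1
    exact funext fun z => congrFun (Set.indicator_compl_add_self F (ω.1 x)) z
  have h2 := hN.add (hasSum_pi_single (0 : ℤ) (∑' z : F, ω.1 x z))
  rw [h1] at h2
  convert h2 using 1
  funext y
  by_cases hy : y = 0
  · subst hy
    simp [truncFun, F]
    rfl
  · by_cases hl : (y.natAbs : ℕ∞) < ϱ
    · simp [truncFun, F, hy, hl, not_le.2 hl]
    · simp [truncFun, F, hy, hl, not_lt.1 hl]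

/-- The truncated environment `ω^ϱ`. -/
noncomputable def trunc (ϱ : ℕ∞) (ω : Environment) : Environment :=
  ⟨truncFun ϱ ω, hasSum_truncFun ϱ ω⟩

/-- Without truncation, `ω^∞ = ω`. -/
theorem trunc_top (ω : Environment) : trunc ⊤ ω = ω := by
  apply Subtype.ext
  funext x y
  by_cases hy : y = 0
  · have : IsEmpty {z : ℤ // z ≠ 0 ∧ (⊤ : ℕ∞) ≤ (z.natAbs : ℕ∞)} :=
      ⟨fun z => ENat.natCast_ne_top _ (top_le_iff.1 z.2.2)⟩
    simp only [trunc, truncFun, hy, if_true, tsum_empty, add_zero]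
  · simp [trunc, truncFun, hy]

/-- The law of the jump from `x` in the environment `ω`. -/
noncomputable def jumpLaw (ω : Environment) (x : ℤ) : PMF ℤ :=
  ⟨fun y => (ω.1 x y : ℝ≥0∞), by
    rw [← ENNReal.coe_one]
    exact ENNReal.hasSum_coe.mpr (ω.2 x)⟩

/-- One step of the walk in the environment `ω`: from `x` to `x + y` with probability `ω x y`. -/
noncomputable def stepKernel (ω : Environment) : Kernel ℤ ℤ :=
  Kernel.ofFunOfCountable fun x => ((jumpLaw ω x).map (fun y => x + y)).toMeasure

instance (ω : Environment) : IsMarkovKernel (stepKernel ω) :=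
  ⟨fun x => by
    change IsProbabilityMeasure ((jumpLaw ω x).map (fun y => x + y)).toMeasure
    infer_instance⟩

/-- The law of the position at time `n + 1` given the trajectory up to time `n`. -/
noncomputable def historyKernel (ω : Environment) (n : ℕ) :
    Kernel ((_ : Finset.Iic n) → ℤ) ℤ :=
  (stepKernel ω).comap (fun h => h ⟨n, Finset.mem_Iic.2 le_rfl⟩) (measurable_pi_apply _)

instance (ω : Environment) (n : ℕ) : IsMarkovKernel (historyKernel ω n) := by
  unfold historyKernel
  infer_instance

/-- The quenched law: the law, on the space of trajectories, of the Markov chain with transition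
probabilities `ω` that starts from `x₀`. -/
noncomputable def quenchedLaw (ω : Environment) (x₀ : ℤ) : Measure (ℕ → ℤ) :=
  Kernel.traj (X := fun _ => ℤ) (historyKernel ω) 0 (fun _ => x₀)

/-- The total number of visits of a trajectory to the site `x`. -/
noncomputable def visits (x : ℤ) (S : ℕ → ℤ) : ℝ≥0∞ :=
  ∑' k : ℕ, if S k = x then 1 else 0

/-- One-sided uniform ellipticity. -/
def ConditionE (P : Measure Environment) : Prop :=
  ∃ ε : ℝ≥0, 0 < ε ∧ ∀ᵐ ω ∂P, ε ≤ ω.1 0 1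

/-- Uniform polynomial tails of the jumps. -/
def ConditionC (P : Measure Environment) : Prop :=
  ∃ γ α : ℝ, 0 < γ ∧ 1 < α ∧ ∀ s : ℝ, 1 ≤ s →
    ∀ᵐ ω ∂P, ∑' y : {y : ℤ // s ≤ |(y : ℝ)|}, (ω.1 0 y : ℝ) ≤ γ * s ^ (-α)

/-- Uniform transience to the right, for all finite truncation levels `ϱ ≥ ϱ₀`. -/
def ConditionD (P : Measure Environment) (ϱ₀ : ℕ) : Prop :=
  ∃ g : ℕ → ℝ, (∀ k, 0 ≤ g k) ∧ Antitone g ∧ Summable (fun k : ℕ => (k : ℝ) * g k) ∧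
    ∀ x : ℤ, x ≤ 0 → ∀ ϱ : ℕ, ϱ₀ ≤ ϱ → ∀ᵐ ω ∂P,
      ∫⁻ S, visits x S ∂(quenchedLaw (trunc (ϱ : ℕ∞) ω) 0) ≤ ENNReal.ofReal (g x.natAbs)

end RWRE

/-!
The proof constructs an invariant measure for the environment viewed from the walker and applies
the ergodic theorem to the jumps of the walk.

All truncation levels are treated at once. The truncated environment is again stationary, ergodic
and elliptic, its mean jump length is bounded (summing the tails of Condition C), and its Green
function `green`, the expected number of visits to a site, satisfies the bounds of Condition D. For
`ϱ = ∞` these bounds pass to the limit, since a path with finitely many jumps is not affected by a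
truncation at a high level (`green_le_of_trunc`). So it suffices to treat environments that are
`Regular`.

*Invariant measure* (`exists_invariant`). By the maximum principle the Green function is bounded by
its values on the diagonal, hence by `g 0`. Therefore the densities
`m⁻¹ ∑_{0 ≤ k < m} G(-k, 0)` are bounded and have a weak limit in `L²`. The Green function is
superinvariant, so the failure of invariance is at most the mean flow out of `[0, m)`. By
stationarity this flow is bounded by the mean jump length, uniformly in `m`, so it disappears after
division by `m`. The limit is not zero: the displacement of the walk is at most linear in time and
its stay to the left of the origin is short, so its stay in `[0, m)` has mean of order `m`.
Ellipticity and ergodicity of the shift make the invariant measure equivalent to `P`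
(`absolutelyContinuous_invariant`).

*Ergodicity* (`ergodic_stepMap`). The quenched probability of an invariant event is a harmonic
function of the environment, so it does not decrease along the shift, and it is a constant `c`
(`harmonic_ae_const`). By the Markov property the event is then independent of the first `n` jumps
for every `n`, hence of itself, so that `c = c ^ 2`. The theorem of Birkhoff, proved first, gives
the law of large numbers, and the equivalence with `P` transfers it to `P`-almost every
environment.

*Positive speed* (`Regular.speed_pos`). A walk of speed at most `0` would stay below `n / D` up to
time `n`, for every `D`, but the mean time spent there is at most of order `g 0 * n / D`.
-/

namespace RWRE

/-! ### The pointwise ergodic theorem -/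

section Birkhoff

variable {X : Type*}

/-- The running maximum `max_{k ≤ n} ∑_{i < k} f ∘ T^i` of the Birkhoff sums, defined through the
recursion it satisfies. -/
noncomputable def birkhoffMax (T : X → X) (f : X → ℝ) : ℕ → X → ℝ
  | 0, _ => 0
  | n + 1, x => max 0 (f x + birkhoffMax T f n (T x))

variable {T : X → X} {f : X → ℝ}

theorem birkhoffMax_nonneg (n : ℕ) (x : X) : 0 ≤ birkhoffMax T f n x := by
  cases n with
  | zero => exact le_rfl
  | succ n => exact le_max_left _ _

theorem birkhoffMax_mono (x : X) : Monotone fun n => birkhoffMax T f n x := by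
  refine monotone_nat_of_le_succ fun n => ?_
  induction n generalizing x with
  | zero => exact birkhoffMax_nonneg 1 x
  | succ n ih => exact max_le_max_left _ (by gcongr; exact ih (T x))

theorem birkhoffSum_le_birkhoffMax (n : ℕ) (x : X) :
    birkhoffSum T f n x ≤ birkhoffMax T f n x := by
  induction n generalizing x with
  | zero => simp [birkhoffMax]
  | succ n ih =>
    rw [birkhoffSum_succ']
    exact le_max_of_le_right (by gcongr; exact ih (T x))

variable [MeasurableSpace X] {μ : Measure X}

theorem measurable_birkhoffMax (hT : Measurable T) (hf : Measurable f) (n : ℕ) :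
    Measurable (birkhoffMax T f n) := by
  induction n with
  | zero => exact measurable_const
  | succ n ih => exact measurable_const.max (hf.add (ih.comp hT))

theorem integrable_birkhoffMax [IsFiniteMeasure μ] (hT : MeasurePreserving T μ μ)
    (hfi : Integrable f μ) (n : ℕ) : Integrable (birkhoffMax T f n) μ := by
  induction n with
  | zero => exact integrable_zero _ _ _
  | succ n ih => exact (integrable_zero _ _ _).sup (hfi.add (hT.integrable_comp_of_integrable ih))

/-- The set where the Birkhoff sums are unbounded above is invariant, and if it had full measure,
then the nonnegative integrals `∫ (M_{n+1} - M_n ∘ T)`, where `M_n` is the running maximum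
`birkhoffMax T f n`, would converge to `∫ f < 0`. -/
theorem ae_bddAbove_birkhoffSum [IsProbabilityMeasure μ] (hT : Ergodic T μ) (hf : Measurable f)
    (hfi : Integrable f μ) (hneg : ∫ x, f x ∂μ < 0) :
    ∀ᵐ x ∂μ, BddAbove (Set.range fun n => birkhoffSum T f n x) := by
  have hTm : Measurable T := hT.toMeasurePreserving.measurable
  have hMm := measurable_birkhoffMax (T := T) (f := f) hTm hf
  let A : Set X := {x | BddAbove (Set.range fun n => birkhoffMax T f n x)}
  have hA : MeasurableSet A := measurableSet_bddAbove_range fun n => hMm n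
  have hinv : T ⁻¹' A = A := by
    ext x
    constructor
    · rintro ⟨b, hb⟩
      refine ⟨max 0 (f x + b), ?_⟩
      rintro _ ⟨n, rfl⟩
      refine (birkhoffMax_mono x n.le_succ).trans (max_le_max_left _ ?_)
      gcongr
      exact hb ⟨n, rfl⟩
    · rintro ⟨b, hb⟩
      refine ⟨b - f x, ?_⟩
      rintro _ ⟨n, rfl⟩
      have h1 := hb ⟨n + 1, rfl⟩
      have h2 : f x + birkhoffMax T f n (T x) ≤ birkhoffMax T f (n + 1) x := le_max_right _ _
      simp only at h1
      linarith
  rcases hT.ae_mem_or_ae_notMem hA hinv with h | h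
  · filter_upwards [h] with x hx
    obtain ⟨b, hb⟩ := hx
    refine ⟨b, ?_⟩
    rintro _ ⟨n, rfl⟩
    exact (birkhoffSum_le_birkhoffMax n x).trans (hb ⟨n, rfl⟩)
  exfalso
  let D : ℕ → X → ℝ := fun n x => birkhoffMax T f (n + 1) x - birkhoffMax T f n (T x)
  have hD : ∀ n x, D n x = max (-birkhoffMax T f n (T x)) (f x) := by
    intro n x
    simp only [D, birkhoffMax]
    rw [← max_sub_sub_right]
    congr 1 <;> ring
  have hDint : ∀ n, 0 ≤ ∫ x, D n x ∂μ := by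
    intro n
    have hMi := integrable_birkhoffMax (f := f) hT.toMeasurePreserving hfi
    have h1 : ∫ x, birkhoffMax T f n (T x) ∂μ = ∫ x, birkhoffMax T f n x ∂μ := by
      conv_rhs => rw [← hT.toMeasurePreserving.map_eq]
      rw [integral_map hTm.aemeasurable (hMm n).aestronglyMeasurable]
    have h2 : ∫ x, D n x ∂μ
        = ∫ x, birkhoffMax T f (n + 1) x ∂μ - ∫ x, birkhoffMax T f n (T x) ∂μ :=
      integral_sub (hMi (n + 1)) (hT.toMeasurePreserving.integrable_comp_of_integrable (hMi n))
    rw [h2, h1, sub_nonneg]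
    exact integral_mono (hMi n) (hMi (n + 1)) fun x => birkhoffMax_mono x n.le_succ
  have hlim : Tendsto (fun n => ∫ x, D n x ∂μ) atTop (𝓝 (∫ x, f x ∂μ)) := by
    refine tendsto_integral_of_dominated_convergence (fun x => |f x|)
      (fun n => ((hMm (n + 1)).sub ((hMm n).comp hTm)).aestronglyMeasurable) hfi.abs ?_ ?_
    · refine fun n => ae_of_all _ fun x => ?_
      rw [hD, Real.norm_eq_abs]
      have := birkhoffMax_nonneg (T := T) (f := f) n (T x)
      rw [abs_le]
      exact ⟨le_max_of_le_right (neg_abs_le _),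
        max_le (by linarith [abs_nonneg (f x)]) (le_abs_self _)⟩
    · filter_upwards [h] with x hx
      have hx' : T x ∉ A := by
        intro hTx
        exact hx (hinv ▸ hTx : x ∈ A)
      have hinf : Tendsto (fun n => birkhoffMax T f n (T x)) atTop atTop :=
        tendsto_atTop_atTop_of_monotone' (birkhoffMax_mono (T x)) hx'
      refine tendsto_const_nhds.congr' ?_
      filter_upwards [hinf.eventually_ge_atTop (-f x)] with n hn
      rw [hD, max_eq_right (by linarith)]
  exact absurd (ge_of_tendsto' hlim hDint) (not_le.2 hneg)

theorem ae_eventually_birkhoffAverage_lt [IsProbabilityMeasure μ] (hT : Ergodic T μ)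
    (hf : Measurable f) (hfi : Integrable f μ) {c : ℝ} (hc : ∫ x, f x ∂μ < c) :
    ∀ᵐ x ∂μ, ∀ᶠ n in atTop, birkhoffAverage ℝ T f n x < c := by
  obtain ⟨d, hd, hdc⟩ := exists_between hc
  have hfi' : Integrable (fun x => f x - d) μ := hfi.sub (integrable_const d)
  have hneg : ∫ x, (f x - d) ∂μ < 0 := by
    rw [integral_sub hfi (integrable_const d)]
    simpa using hd
  filter_upwards [ae_bddAbove_birkhoffSum hT (hf.sub_const d) hfi' hneg] with x hx
  obtain ⟨b, hb⟩ := hx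
  have hlim : Tendsto (fun n : ℕ => b / (n : ℝ)) atTop (𝓝 0) :=
    tendsto_const_div_atTop_nhds_zero_nat b
  filter_upwards [hlim.eventually_lt_const (sub_pos.2 hdc), eventually_gt_atTop 0] with n hn hn0
  have hn0' : (0 : ℝ) < n := by exact_mod_cast hn0
  have h1 : birkhoffSum T (fun x => f x - d) n x ≤ b := hb ⟨n, rfl⟩
  have h2 : birkhoffSum T (fun x => f x - d) n x = birkhoffSum T f n x - n * d := by
    simp [birkhoffSum, Finset.sum_sub_distrib]
  rw [birkhoffAverage, smul_eq_mul, inv_mul_lt_iff₀ hn0']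
  rw [div_lt_iff₀ hn0'] at hn
  rw [h2] at h1
  nlinarith

/-- **Birkhoff's ergodic theorem** for an ergodic transformation. -/
theorem ae_tendsto_birkhoffAverage [IsProbabilityMeasure μ] (hT : Ergodic T μ)
    (hf : Measurable f) (hfi : Integrable f μ) :
    ∀ᵐ x ∂μ, Tendsto (fun n => birkhoffAverage ℝ T f n x) atTop (𝓝 (∫ x, f x ∂μ)) := by
  have hup : ∀ k : ℕ, ∀ᵐ x ∂μ, ∀ᶠ n in atTop,
      birkhoffAverage ℝ T f n x < ∫ x, f x ∂μ + 1 / (k + 1 : ℝ) := fun k =>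
    ae_eventually_birkhoffAverage_lt hT hf hfi (lt_add_of_pos_right _ (by positivity))
  have hlow : ∀ k : ℕ, ∀ᵐ x ∂μ, ∀ᶠ n in atTop,
      ∫ x, f x ∂μ - 1 / (k + 1 : ℝ) < birkhoffAverage ℝ T f n x := by
    intro k
    have h0 : ∫ x, (-f) x ∂μ < -(∫ x, f x ∂μ - 1 / (k + 1 : ℝ)) := by
      have : (0 : ℝ) < 1 / (k + 1 : ℝ) := by positivity
      simp only [Pi.neg_apply, integral_neg]
      linarith
    filter_upwards [ae_eventually_birkhoffAverage_lt hT hf.neg hfi.neg h0] with x hx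
    filter_upwards [hx] with n hn
    rw [birkhoffAverage_neg] at hn
    exact neg_lt_neg_iff.1 hn
  filter_upwards [ae_all_iff.2 hup, ae_all_iff.2 hlow] with x hx1 hx2
  rw [tendsto_order]
  constructor
  · intro a ha
    obtain ⟨k, hk⟩ := exists_nat_one_div_lt (sub_pos.2 ha)
    filter_upwards [hx2 k] with n hn
    linarith
  · intro a ha
    obtain ⟨k, hk⟩ := exists_nat_one_div_lt (sub_pos.2 ha)
    filter_upwards [hx1 k] with n hn
    linarith

end Birkhoff

/-! ### Weak limits of bounded densities -/

/-- A uniformly bounded sequence of functions on a probability space has, along the ultrafilter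
`hyperfilter ℕ`, a weak limit in `L²`, by the Banach-Alaoglu theorem. -/
theorem exists_weak_limit {X : Type*} [MeasurableSpace X] (P : Measure X) [IsProbabilityMeasure P]
    (h : ℕ → X → ℝ) (hm : ∀ n, Measurable (h n)) (C : ℝ) (hC : ∀ n, ∀ᵐ x ∂P, |h n x| ≤ C) :
    ∃ H : X → ℝ, Integrable H P ∧ ∀ f : X → ℝ, Measurable f → (∃ D : ℝ, ∀ x, |f x| ≤ D) →
      Tendsto (fun n => ∫ x, h n x * f x ∂P) (hyperfilter ℕ : Filter ℕ)
        (𝓝 (∫ x, H x * f x ∂P)) := by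
  have hmem : ∀ n, MemLp (h n) 2 P := fun n =>
    MemLp.of_bound (hm n).aestronglyMeasurable C (hC n)
  let u : ℕ → Lp ℝ 2 P := fun n => (hmem n).toLp (h n)
  have hu : ∀ n, ‖u n‖ ≤ |C| := by
    intro n
    have h1 : ∀ᵐ x ∂P, ‖u n x‖ ≤ |C| := by
      filter_upwards [(hmem n).coeFn_toLp, hC n] with x hx hx2
      rw [hx]
      exact hx2.trans (le_abs_self C)
    have := Lp.norm_le_of_ae_bound (abs_nonneg C) h1
    simpa [measureUnivNNReal] using this
  let φ : ℕ → WeakDual ℝ (Lp ℝ 2 P) := fun n =>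
    StrongDual.toWeakDual (InnerProductSpace.toDual ℝ (Lp ℝ 2 P) (u n))
  have hK : IsCompact (WeakDual.toStrongDual ⁻¹'
      Metric.closedBall (0 : StrongDual ℝ (Lp ℝ 2 P)) |C|) :=
    WeakDual.isCompact_closedBall 0 |C|
  have hφ : ∀ n, φ n ∈ WeakDual.toStrongDual ⁻¹'
      Metric.closedBall (0 : StrongDual ℝ (Lp ℝ 2 P)) |C| := by
    intro n
    simp only [Set.mem_preimage, mem_closedBall_zero_iff]
    change ‖InnerProductSpace.toDual ℝ (Lp ℝ 2 P) (u n)‖ ≤ |C|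
    simpa using hu n
  obtain ⟨ψ, -, hψ⟩ := hK.ultrafilter_le_nhds ((hyperfilter ℕ).map φ)
    (by
      rw [Ultrafilter.coe_map, le_principal_iff, mem_map]
      exact univ_mem' hφ)
  let v : Lp ℝ 2 P := (InnerProductSpace.toDual ℝ (Lp ℝ 2 P)).symm (WeakDual.toStrongDual ψ)
  refine ⟨v, (Lp.memLp v).integrable (by norm_num), fun f hf hfD => ?_⟩
  obtain ⟨D, hD⟩ := hfD
  have hfm : MemLp f 2 P := MemLp.of_bound hf.aestronglyMeasurable D (ae_of_all _ hD)
  have h1 : Tendsto (fun n => φ n (hfm.toLp f)) (hyperfilter ℕ : Filter ℕ)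
      (𝓝 (ψ (hfm.toLp f))) := by
    have h2 : Tendsto φ (hyperfilter ℕ : Filter ℕ) (𝓝 ψ) := hψ
    exact ((WeakDual.eval_continuous (hfm.toLp f)).tendsto ψ).comp h2
  have h3 : ∀ w : Lp ℝ 2 P, inner ℝ w (hfm.toLp f) = ∫ x, w x * f x ∂P := by
    intro w
    rw [L2.inner_def]
    refine integral_congr_ae ?_
    filter_upwards [hfm.coeFn_toLp] with x hx
    rw [hx]
    simp [mul_comm]
  have h4 : ψ (hfm.toLp f) = ∫ x, v x * f x ∂P := by
    rw [← h3, InnerProductSpace.toDual_symm_apply]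
    rfl
  rw [← h4]
  refine h1.congr fun n => ?_
  have h5 : φ n (hfm.toLp f) = inner ℝ (u n) (hfm.toLp f) := rfl
  rw [h5, h3]
  refine integral_congr_ae ?_
  filter_upwards [(hmem n).coeFn_toLp] with x hx
  rw [hx]

/-! ### The law of the sequence of jumps -/

/-- The position at time `n` of the walk that starts from `0` and makes the jumps `ξ`. -/
def walk (ξ : ℕ → ℤ) (n : ℕ) : ℤ := ∑ i ∈ Finset.range n, ξ i

/-- The jumps of a trajectory. -/
def jumps (S : ℕ → ℤ) (n : ℕ) : ℤ := S (n + 1) - S n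

/-- The sequence `y, ξ 0, ξ 1, …`. -/
def consJump (y : ℤ) (ξ : ℕ → ℤ) : ℕ → ℤ
  | 0 => y
  | n + 1 => ξ n

/-- The sequences whose first `n` terms are those of `a`. -/
def cyl (n : ℕ) (a : ℕ → ℤ) : Set (ℕ → ℤ) := {ξ | ∀ i < n, ξ i = a i}

theorem walk_zero (ξ : ℕ → ℤ) : walk ξ 0 = 0 := rfl

theorem walk_succ' (ξ : ℕ → ℤ) (n : ℕ) : walk ξ (n + 1) = ξ 0 + walk (fun i => ξ (i + 1)) n := by
  simp [walk, Finset.sum_range_succ', add_comm]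

theorem walk_consJump (y : ℤ) (ξ : ℕ → ℤ) (n : ℕ) :
    walk (consJump y ξ) (n + 1) = y + walk ξ n := walk_succ' _ _

theorem measurable_walk (n : ℕ) : Measurable fun ξ => walk ξ n :=
  Finset.measurable_sum _ fun i _ => measurable_pi_apply i

theorem measurable_jumps : Measurable jumps :=
  measurable_pi_iff.2 fun n => (measurable_pi_apply (n + 1)).sub (measurable_pi_apply n)

theorem measurable_consJump (y : ℤ) : Measurable (consJump y) := by
  refine measurable_pi_iff.2 fun n => ?_
  cases n with
  | zero => exact measurable_const
  | succ n => exact measurable_pi_apply n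

theorem cyl_zero (a : ℕ → ℤ) : cyl 0 a = Set.univ := by
  ext
  simp [cyl]

theorem consJump_preimage_cyl (n : ℕ) (a : ℕ → ℤ) :
    consJump (a 0) ⁻¹' cyl (n + 1) a = cyl n fun i => a (i + 1) := by
  ext ξ
  constructor
  · intro h i hi
    exact h (i + 1) (by omega)
  · intro h i hi
    cases i with
    | zero => rfl
    | succ i => exact h i (by omega)

theorem consJump_preimage_cyl_of_ne {y : ℤ} {a : ℕ → ℤ} (hy : y ≠ a 0) (n : ℕ) :
    consJump y ⁻¹' cyl (n + 1) a = ∅ := by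
  ext ξ
  simp only [Set.mem_preimage, Set.mem_empty_iff_false, iff_false]
  exact fun h => hy (h 0 n.succ_pos)

theorem measurableSet_cyl (n : ℕ) (a : ℕ → ℤ) : MeasurableSet (cyl n a) := by
  have : cyl n a = ⋂ i < n, {ξ | ξ i = a i} := by
    ext ξ
    simp [cyl]
  rw [this]
  exact MeasurableSet.biInter (Set.to_countable _) fun i _ =>
    (measurableSet_singleton (a i)).preimage (measurable_pi_apply (X := fun _ : ℕ => ℤ) i)

theorem isPiSystem_cyl : IsPiSystem {s | ∃ n a, s = cyl n a} := by
  have key : ∀ n m a b, n ≤ m → (cyl n a ∩ cyl m b).Nonempty → cyl n a ∩ cyl m b = cyl m b := by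
    rintro n m a b hnm ⟨ξ, h1, h2⟩
    refine Set.inter_eq_right.2 fun η hη i hi => ?_
    rw [hη i (hi.trans_le hnm), ← h2 i (hi.trans_le hnm), h1 i hi]
  rintro _ ⟨n, a, rfl⟩ _ ⟨m, b, rfl⟩ hne
  rcases le_total n m with h | h
  · exact ⟨m, b, key n m a b h hne⟩
  · rw [Set.inter_comm] at hne ⊢
    exact ⟨n, a, key m n b a h hne⟩

theorem generateFrom_cyl : (inferInstance : MeasurableSpace (ℕ → ℤ)) =
    MeasurableSpace.generateFrom {s | ∃ n a, s = cyl n a} := by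
  refine le_antisymm ?_ (MeasurableSpace.generateFrom_le ?_)
  · refine iSup_le fun i => ?_
    rw [← measurable_iff_comap_le]
    refine @measurable_to_countable' ℤ (ℕ → ℤ) _ _ (_) _ fun z => ?_
    let e : (Fin i → ℤ) → ℕ → ℤ := fun a k => if h : k < i then a ⟨k, h⟩ else z
    have hU : (fun ξ : ℕ → ℤ => ξ i) ⁻¹' {z} = ⋃ a : Fin i → ℤ, cyl (i + 1) (e a) := by
      ext ξ
      simp only [Set.mem_preimage, Set.mem_singleton_iff, Set.mem_iUnion]
      constructor
      · intro h
        refine ⟨fun k => ξ k, fun k hk => ?_⟩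
        by_cases hki : k < i
        · simp [e, hki]
        · have : k = i := by omega
          subst this
          simp [e, h]
      · rintro ⟨a, ha⟩
        simpa [e] using ha i i.lt_succ_self
    rw [hU]
    refine MeasurableSet.iUnion fun a => ?_
    exact MeasurableSpace.measurableSet_generateFrom ⟨_, _, rfl⟩
  · rintro _ ⟨n, a, rfl⟩
    exact measurableSet_cyl n a

theorem ext_of_cyl {μ ν : Measure (ℕ → ℤ)} [IsFiniteMeasure μ]
    (h : ∀ n a, μ (cyl n a) = ν (cyl n a)) : μ = ν := by
  refine ext_of_generate_finite _ generateFrom_cyl isPiSystem_cyl ?_ ?_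
  · rintro _ ⟨n, a, rfl⟩
    exact h n a
  · rw [← cyl_zero fun _ => 0]
    exact h _ _

instance (ω : Environment) (x : ℤ) : IsProbabilityMeasure (quenchedLaw ω x) := by
  unfold quenchedLaw
  infer_instance

theorem stepKernel_singleton (ω : Environment) (x z : ℤ) :
    stepKernel ω x {z} = (ω.1 x (z - x) : ℝ≥0∞) := by
  change ((jumpLaw ω x).map (fun y => x + y)).toMeasure {z} = _
  rw [PMF.toMeasure_apply_singleton _ _ (measurableSet_singleton z), PMF.map_apply,
    tsum_eq_single (z - x)]
  · simp only [add_sub_cancel, if_true]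
    rfl
  · intro y hy
    rw [if_neg]
    intro h
    apply hy
    omega

theorem ae_quenchedLaw_zero (ω : Environment) (x : ℤ) : ∀ᵐ S ∂quenchedLaw ω x, S 0 = x := by
  have h := Kernel.traj_map_frestrictLe_apply (X := fun _ => ℤ) (κ := historyKernel ω) 0 0
    (fun _ => x)
  rw [Kernel.partialTraj_self, Kernel.id_apply] at h
  have h2 : ∀ᵐ y ∂((quenchedLaw ω x).map (Preorder.frestrictLe (π := fun _ => ℤ) 0)),
      y ⟨0, Finset.mem_Iic.2 le_rfl⟩ = x := by
    unfold quenchedLaw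
    rw [h, ae_dirac_eq]
    rfl
  exact ae_of_ae_map (by fun_prop) h2

theorem quenchedLaw_path (ω : Environment) (b : ℕ → ℤ) (n : ℕ) :
    quenchedLaw ω (b 0) {S | ∀ i ≤ n, S i = b i}
      = ∏ i ∈ Finset.range n, (ω.1 (b i) (b (i + 1) - b i) : ℝ≥0∞) := by
  induction n with
  | zero =>
    have h : {S : ℕ → ℤ | ∀ i ≤ 0, S i = b i} =ᵐ[quenchedLaw ω (b 0)] Set.univ := by
      filter_upwards [ae_quenchedLaw_zero ω (b 0)] with S hS
      refine eq_true fun i hi => ?_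
      rw [Nat.le_zero.1 hi, hS]
    rw [measure_congr h, measure_univ, Finset.range_zero, Finset.prod_empty]
  | succ n ih =>
    let R : Set ((i : Finset.Iic n) → ℤ) := {h | ∀ i, h i = b i}
    have hR : MeasurableSet R := by
      have : R = ⋂ i : Finset.Iic n, {h | h i = b i} := by
        ext
        simp [R]
      rw [this]
      exact MeasurableSet.iInter fun i =>
        (measurableSet_singleton _).preimage (measurable_pi_apply (X := fun _ => ℤ) i)
    have h := Kernel.partialTraj_compProd_eq_map_traj (X := fun _ => ℤ) (κ := historyKernel ω)
      n.zero_le (x₀ := fun _ => b 0)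
    have h1 := congrArg (fun μ => μ (R ×ˢ {b (n + 1)})) h
    beta_reduce at h1
    rw [Measure.map_apply (by fun_prop) (hR.prod (measurableSet_singleton _)),
      Measure.compProd_apply_prod hR (measurableSet_singleton _)] at h1
    have h2 : (fun x : ℕ → ℤ => (Preorder.frestrictLe (π := fun _ => ℤ) n x, x (n + 1))) ⁻¹'
        (R ×ˢ {b (n + 1)}) = {S | ∀ i ≤ n + 1, S i = b i} := by
      ext S
      simp only [R, Set.mem_preimage, Set.mem_prod, Set.mem_ofPred_eq, Set.mem_singleton_iff,
        Subtype.forall, Finset.mem_Iic, Preorder.frestrictLe_apply]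
      constructor
      · rintro ⟨h1, h2⟩ i hi
        rcases Nat.le_succ_iff.1 hi with h | rfl
        · exact h1 i h
        · exact h2
      · exact fun h => ⟨fun i hi => h i (by omega), h _ le_rfl⟩
    rw [h2] at h1
    rw [Finset.prod_range_succ, ← ih]
    refine h1.symm.trans ?_
    have h3 : ∀ x ∈ R, historyKernel ω n x {b (n + 1)}
        = (ω.1 (b n) (b (n + 1) - b n) : ℝ≥0∞) := by
      intro x hx
      rw [historyKernel, Kernel.comap_apply, hx ⟨n, _⟩, stepKernel_singleton]
    rw [setLIntegral_congr_fun hR h3, setLIntegral_const, mul_comm]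
    congr 1
    rw [← Kernel.traj_map_frestrictLe_apply, Measure.map_apply (by fun_prop) hR]
    congr 1
    ext S
    simp [R]

/-- The quenched law of the sequence of jumps of the walk that starts from `0`. -/
noncomputable def jumpsLaw (ω : Environment) : Measure (ℕ → ℤ) := (quenchedLaw ω 0).map jumps

instance (ω : Environment) : IsProbabilityMeasure (jumpsLaw ω) :=
  Measure.isProbabilityMeasure_map measurable_jumps.aemeasurable

theorem jumpsLaw_cyl (ω : Environment) (n : ℕ) (a : ℕ → ℤ) :
    jumpsLaw ω (cyl n a) = ∏ i ∈ Finset.range n, (ω.1 (walk a i) (a i) : ℝ≥0∞) := by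
  have h := quenchedLaw_path ω (walk a) n
  simp only [walk, Finset.sum_range_succ, add_sub_cancel_left, Finset.range_zero,
    Finset.sum_empty] at h
  rw [jumpsLaw, Measure.map_apply measurable_jumps (measurableSet_cyl n a)]
  refine Eq.trans (measure_congr ?_) h
  filter_upwards [ae_quenchedLaw_zero ω 0] with S hS
  apply propext
  change (∀ i < n, S (i + 1) - S i = a i) ↔ ∀ i ≤ n, S i = ∑ x ∈ Finset.range i, a x
  constructor
  · intro h1 i
    induction i with
    | zero => simp [hS]
    | succ i ih =>
      intro hi
      rw [Finset.sum_range_succ, ← ih (by omega), ← h1 i (by omega)]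
      ring
  · intro h1 i hi
    rw [h1 (i + 1) (by omega), h1 i (by omega), Finset.sum_range_succ]
    ring

theorem measurable_env (x y : ℤ) : Measurable fun ω : Environment => (ω.1 x y : ℝ≥0∞) :=
  measurable_coe_nnreal_ennreal.comp
    ((measurable_pi_apply y).comp ((measurable_pi_apply x).comp measurable_subtype_coe))

theorem tsum_env (ω : Environment) (x : ℤ) : ∑' y, (ω.1 x y : ℝ≥0∞) = 1 := by
  rw [← ENNReal.coe_tsum (ω.2 x).summable, (ω.2 x).tsum_eq, ENNReal.coe_one]

theorem measurable_jumpsLaw : Measurable jumpsLaw := by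
  refine .measure_of_isPiSystem_of_isProbabilityMeasure generateFrom_cyl isPiSystem_cyl ?_
  rintro _ ⟨n, a, rfl⟩
  simp only [jumpsLaw_cyl]
  exact Finset.measurable_prod _ fun i _ => measurable_env _ _

theorem shift_apply (z : ℤ) (ω : Environment) (x y : ℤ) :
    (shift z ω).1 x y = ω.1 (x + z) y := rfl

theorem shift_shift (z w : ℤ) (ω : Environment) : shift z (shift w ω) = shift (z + w) ω := by
  apply Subtype.ext
  funext x y
  simp only [shift_apply, add_assoc]

theorem shift_zero (ω : Environment) : shift 0 ω = ω := by
  apply Subtype.ext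
  funext x y
  simp only [shift_apply, add_zero]

/-- The first-step decomposition of the law of the jumps. -/
theorem jumpsLaw_eq_sum (ω : Environment) :
    jumpsLaw ω = Measure.sum fun y : ℤ =>
      (ω.1 0 y : ℝ≥0∞) • (jumpsLaw (shift y ω)).map (consJump y) := by
  refine ext_of_cyl fun n a => ?_
  rw [Measure.sum_apply _ (measurableSet_cyl n a)]
  simp only [Measure.smul_apply, smul_eq_mul,
    Measure.map_apply (measurable_consJump _) (measurableSet_cyl n a)]
  cases n with
  | zero =>
    simp [cyl_zero, tsum_env]
  | succ n =>
    rw [tsum_eq_single (a 0)]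
    · rw [consJump_preimage_cyl, jumpsLaw_cyl, jumpsLaw_cyl, Finset.prod_range_succ',
        mul_comm, walk_zero]
      congr 1
      refine Finset.prod_congr rfl fun i _ => ?_
      rw [walk_succ', shift_apply, add_comm]
    · intro y hy
      rw [consJump_preimage_cyl_of_ne hy, measure_empty, mul_zero]

theorem lintegral_jumpsLaw (ω : Environment) {F : (ℕ → ℤ) → ℝ≥0∞} (hF : Measurable F) :
    ∫⁻ ξ, F ξ ∂jumpsLaw ω
      = ∑' y : ℤ, (ω.1 0 y : ℝ≥0∞) * ∫⁻ ξ, F (consJump y ξ) ∂jumpsLaw (shift y ω) := by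
  conv_lhs => rw [jumpsLaw_eq_sum]
  rw [lintegral_sum_measure]
  refine tsum_congr fun y => ?_
  rw [lintegral_smul_measure, lintegral_map hF (measurable_consJump y), smul_eq_mul]

theorem jumpsLaw_apply (ω : Environment) {s : Set (ℕ → ℤ)} (hs : MeasurableSet s) :
    jumpsLaw ω s
      = ∑' y : ℤ, (ω.1 0 y : ℝ≥0∞) * jumpsLaw (shift y ω) (consJump y ⁻¹' s) := by
  conv_lhs => rw [jumpsLaw_eq_sum]
  rw [Measure.sum_apply _ hs]
  refine tsum_congr fun y => ?_
  rw [Measure.smul_apply, smul_eq_mul, Measure.map_apply (measurable_consJump y) hs]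

/-! ### Green function -/

/-- The probability that the walk from `0` is at `z` at time `n`. -/
noncomputable def reach (ω : Environment) (n : ℕ) (z : ℤ) : ℝ≥0∞ :=
  jumpsLaw ω {ξ | walk ξ n = z}

/-- The expected number of visits to `z` of the walk from `0`. -/
noncomputable def green (ω : Environment) (z : ℤ) : ℝ≥0∞ := ∑' n, reach ω n z

theorem measurableSet_walk_eq (n : ℕ) (z : ℤ) : MeasurableSet {ξ | walk ξ n = z} :=
  (measurableSet_singleton z).preimage (measurable_walk n)

theorem reach_zero (ω : Environment) (z : ℤ) : reach ω 0 z = if z = 0 then 1 else 0 := by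
  by_cases hz : z = 0
  · simp [reach, walk_zero, hz]
  · simp [reach, walk_zero, hz, Ne.symm hz]

theorem reach_succ (ω : Environment) (n : ℕ) (z : ℤ) :
    reach ω (n + 1) z = ∑' y : ℤ, (ω.1 0 y : ℝ≥0∞) * reach (shift y ω) n (z - y) := by
  rw [reach, jumpsLaw_apply ω (measurableSet_walk_eq _ _)]
  refine tsum_congr fun y => ?_
  congr 2
  ext ξ
  change walk (consJump y ξ) (n + 1) = z ↔ walk ξ n = z - y
  rw [walk_consJump]
  omega

/-- The last-step decomposition. -/
theorem reach_succ_eq_tsum_last (ω : Environment) (n : ℕ) (z : ℤ) :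
    reach ω (n + 1) z = ∑' w : ℤ, reach ω n w * (ω.1 w (z - w) : ℝ≥0∞) := by
  induction n generalizing ω z with
  | zero =>
    rw [reach_succ, tsum_eq_single z, tsum_eq_single (0 : ℤ)]
    · simp [reach_zero]
    · intro w hw
      simp [reach_zero, hw]
    · intro y hy
      rw [reach_zero, if_neg (by omega), mul_zero]
  | succ n ih =>
    rw [reach_succ]
    have h1 : ∀ y : ℤ, reach (shift y ω) (n + 1) (z - y)
        = ∑' w : ℤ, reach (shift y ω) n (w - y) * (ω.1 w (z - w) : ℝ≥0∞) := by
      intro y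
      rw [ih, ← (Equiv.subRight y).tsum_eq]
      refine tsum_congr fun w => ?_
      simp [shift_apply]
    simp_rw [h1, ← ENNReal.tsum_mul_left]
    rw [ENNReal.tsum_comm]
    refine tsum_congr fun w => ?_
    rw [reach_succ, ← ENNReal.tsum_mul_right]
    exact tsum_congr fun y => (mul_assoc _ _ _).symm

theorem measurable_reach (n : ℕ) (z : ℤ) : Measurable fun ω => reach ω n z :=
  (Measure.measurable_coe (measurableSet_walk_eq n z)).comp measurable_jumpsLaw

theorem measurable_green (z : ℤ) : Measurable fun ω => green ω z :=
  Measurable.tsum fun n => measurable_reach n z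

theorem tsum_green_mul_le (ω : Environment) (z : ℤ) :
    ∑' w : ℤ, green ω w * (ω.1 w (z - w) : ℝ≥0∞) ≤ green ω z := by
  simp_rw [green, ← ENNReal.tsum_mul_right]
  rw [ENNReal.tsum_comm]
  simp_rw [← reach_succ_eq_tsum_last]
  rw [tsum_eq_zero_add' (f := fun n => reach ω n z) ENNReal.summable]
  exact le_add_self

/-- The maximum principle: the Green function is maximal on the diagonal. -/
theorem green_le_of_diag (ω : Environment) (g : ℝ≥0∞) (hg : ∀ x, green (shift x ω) 0 ≤ g)
    (z : ℤ) : green ω z ≤ g := by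
  have key : ∀ (N : ℕ) (x z : ℤ), ∑ n ∈ Finset.range N, reach (shift x ω) n z ≤ g := by
    intro N
    induction N with
    | zero => simp
    | succ N ih =>
      intro x z
      by_cases hz : z = 0
      · rw [hz]
        exact (ENNReal.sum_le_tsum _).trans (hg x)
      · rw [Finset.sum_range_succ', reach_zero, if_neg hz, add_zero]
        simp_rw [reach_succ]
        rw [← Summable.tsum_finsetSum fun _ _ => ENNReal.summable]
        simp_rw [← Finset.mul_sum, shift_shift]
        calc ∑' y : ℤ, ((shift x ω).1 0 y : ℝ≥0∞)
              * ∑ n ∈ Finset.range N, reach (shift (y + x) ω) n (z - y)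
            ≤ ∑' y : ℤ, ((shift x ω).1 0 y : ℝ≥0∞) * g :=
              ENNReal.tsum_le_tsum fun y => by gcongr; exact ih _ _
          _ = g := by rw [ENNReal.tsum_mul_right, tsum_env, one_mul]
  rw [green, ENNReal.tsum_eq_iSup_nat]
  exact iSup_le fun N => by simpa [shift_zero] using key N 0 z

/-- Ellipticity to the right with constant `ε`, mean jump length at most `C`, mean number of
visits to the starting point at most `g` and mean time spent in `(-∞, x]` at most `Γ`, for the walks
from all sites `x` of the environment `ω`. -/
structure Regular (ε : ℝ≥0) (C : ℕ) (g Γ : ℝ≥0) (ω : Environment) : Prop where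
  elliptic : ∀ x, ε ≤ ω.1 x 1
  mean_jump : ∀ x, ∑' y : ℤ, (y.natAbs : ℝ≥0∞) * (ω.1 x y : ℝ≥0∞) ≤ C
  returns : ∀ x, green (shift x ω) 0 ≤ g
  time_left : ∀ x, ∑' k : ℕ, green (shift x ω) (-k) ≤ Γ

variable {ε : ℝ≥0} {C : ℕ} {g Γ : ℝ≥0} {ω : Environment}

theorem Regular.shift (h : Regular ε C g Γ ω) (z : ℤ) : Regular ε C g Γ (shift z ω) where
  elliptic x := h.elliptic (x + z)
  mean_jump x := h.mean_jump (x + z)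
  returns x := by
    rw [shift_shift]
    exact h.returns (x + z)
  time_left x := by
    rw [shift_shift]
    exact h.time_left (x + z)

theorem Regular.green_le (h : Regular ε C g Γ ω) (z : ℤ) : green ω z ≤ g :=
  green_le_of_diag ω g h.returns z

theorem Regular.lintegral_walk_le (h : Regular ε C g Γ ω) (n : ℕ) :
    ∫⁻ ξ, ((walk ξ n).natAbs : ℝ≥0∞) ∂jumpsLaw ω ≤ n * C := by
  have hm : ∀ n, Measurable fun ξ => ((walk ξ n).natAbs : ℝ≥0∞) := fun n =>
    (measurable_of_countable fun z : ℤ => (z.natAbs : ℝ≥0∞)).comp (measurable_walk n)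
  induction n generalizing ω with
  | zero => simp [walk_zero]
  | succ n ih =>
    rw [lintegral_jumpsLaw ω (hm _)]
    calc ∑' y : ℤ, (ω.1 0 y : ℝ≥0∞)
          * ∫⁻ ξ, ((walk (consJump y ξ) (n + 1)).natAbs : ℝ≥0∞) ∂jumpsLaw (RWRE.shift y ω)
        ≤ ∑' y : ℤ, ((y.natAbs : ℝ≥0∞) * (ω.1 0 y : ℝ≥0∞) + (ω.1 0 y : ℝ≥0∞) * (n * C)) := by
          refine ENNReal.tsum_le_tsum fun y => ?_
          rw [mul_comm (y.natAbs : ℝ≥0∞), ← mul_add]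
          gcongr
          calc ∫⁻ ξ, ((walk (consJump y ξ) (n + 1)).natAbs : ℝ≥0∞) ∂jumpsLaw (RWRE.shift y ω)
              ≤ ∫⁻ ξ, ((y.natAbs : ℝ≥0∞) + ((walk ξ n).natAbs : ℝ≥0∞))
                  ∂jumpsLaw (RWRE.shift y ω) := by
                refine lintegral_mono fun ξ => ?_
                rw [walk_consJump]
                rw [← Nat.cast_add, Nat.cast_le]
                exact Int.natAbs_add_le y (walk ξ n)
            _ ≤ y.natAbs + n * C := by
                rw [lintegral_add_left measurable_const, lintegral_const, measure_univ, mul_one]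
                gcongr
                exact ih (h.shift y)
      _ ≤ C + n * C := by
          rw [ENNReal.tsum_add, ENNReal.tsum_mul_right, tsum_env, one_mul]
          gcongr
          exact h.mean_jump 0
      _ = (n + 1 : ℕ) * C := by push_cast; ring

theorem jumpsLaw_walk_mem (ω : Environment) (n : ℕ) (s : Finset ℤ) :
    jumpsLaw ω {ξ | walk ξ n ∈ s} = ∑ k ∈ s, reach ω n k := by
  have : {ξ | walk ξ n ∈ s} = ⋃ k ∈ s, {ξ | walk ξ n = k} := by
    ext
    simp
  rw [this, measure_biUnion_finset]
  · rfl
  · intro a _ b _ hab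
    exact Set.disjoint_left.2 fun ξ (h1 : walk ξ n = a) (h2 : walk ξ n = b) =>
      hab (h1.symm.trans h2)
  · exact fun k _ => measurableSet_walk_eq n k

theorem jumpsLaw_walk_nonpos_le (ω : Environment) (n : ℕ) :
    jumpsLaw ω {ξ | walk ξ n ≤ 0} ≤ ∑' k : ℕ, reach ω n (-k) := by
  refine (measure_mono fun ξ (hξ : walk ξ n ≤ 0) => ?_).trans (measure_iUnion_le _)
  refine Set.mem_iUnion.2 ⟨(walk ξ n).natAbs, ?_⟩
  change walk ξ n = _
  omega

/-- The walk spends a mean time of order at least `m` in `[0, m)`: its mean displacement in time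
`N` is at most `N * C`, so that it is unlikely to leave `(-∞, m)` before time of order `m / C`, and
it spends a bounded mean time in `(-∞, 0)`. -/
theorem Regular.le_sum_green (h : Regular ε C g Γ ω) (N m : ℕ) (hm : m ≠ 0) :
    (N : ℝ≥0∞) ≤ ∑ k ∈ Finset.Ico (0 : ℤ) m, green ω k + Γ + N * (N * C / m) := by
  have hm0 : (m : ℝ≥0∞) ≠ 0 := by exact_mod_cast hm
  have h1 : ∀ n ∈ Finset.range N, (1 : ℝ≥0∞) ≤ ∑ k ∈ Finset.Ico (0 : ℤ) m, reach ω n k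
      + ∑' k : ℕ, reach ω n (-k) + N * C / m := by
    intro n hn
    have h2 : jumpsLaw ω {ξ | (m : ℝ≥0∞) ≤ ((walk ξ n).natAbs : ℝ≥0∞)} ≤ N * C / m := by
      refine (meas_ge_le_lintegral_div ?_ hm0 (ENNReal.natCast_ne_top m)).trans ?_
      · exact ((measurable_of_countable fun z : ℤ => (z.natAbs : ℝ≥0∞)).comp
          (measurable_walk n)).aemeasurable
      · gcongr
        refine (h.lintegral_walk_le n).trans ?_
        gcongr
        exact (Finset.mem_range.1 hn).le
    rw [← jumpsLaw_walk_mem, ← measure_univ (μ := jumpsLaw ω)]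
    refine le_trans (measure_mono (t := {ξ | walk ξ n ∈ Finset.Ico (0 : ℤ) m}
      ∪ {ξ | walk ξ n ≤ 0} ∪ {ξ | (m : ℝ≥0∞) ≤ ((walk ξ n).natAbs : ℝ≥0∞)}) ?_) ?_
    · intro ξ _
      simp only [Set.mem_union, Set.mem_ofPred_eq, Finset.mem_Ico, Nat.cast_le]
      omega
    · refine (measure_union_le _ _).trans (add_le_add ((measure_union_le _ _).trans ?_) h2)
      gcongr
      exact jumpsLaw_walk_nonpos_le ω n
  calc (N : ℝ≥0∞) = ∑ n ∈ Finset.range N, 1 := by simp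
    _ ≤ _ := Finset.sum_le_sum h1
    _ = ∑ k ∈ Finset.Ico (0 : ℤ) m, ∑ n ∈ Finset.range N, reach ω n k
        + ∑' k : ℕ, ∑ n ∈ Finset.range N, reach ω n (-k) + N * (N * C / m) := by
      rw [Finset.sum_add_distrib, Finset.sum_add_distrib, Finset.sum_comm,
        Summable.tsum_finsetSum fun _ _ => ENNReal.summable]
      simp
    _ ≤ _ := by
      gcongr with k _
      · exact ENNReal.sum_le_tsum _
      · refine le_trans (ENNReal.tsum_le_tsum fun k => ?_)
          (by simpa [shift_zero] using h.time_left 0)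
        exact ENNReal.sum_le_tsum _

/-! ### The environment viewed from the walker -/

/-- The transition operator of the environment viewed from the walker. -/
noncomputable def envOp (f : Environment → ℝ≥0∞) (ω : Environment) : ℝ≥0∞ :=
  ∑' y : ℤ, (ω.1 0 y : ℝ≥0∞) * f (shift y ω)

theorem measurable_shift (z : ℤ) : Measurable (shift z) :=
  Measurable.subtype_mk (f := fun ω : Environment => fun x => ω.1 (x + z))
    (measurable_pi_iff.2 fun x => (measurable_pi_apply (x + z)).comp measurable_subtype_coe)

theorem measurable_envOp {f : Environment → ℝ≥0∞} (hf : Measurable f) : Measurable (envOp f) :=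
  Measurable.tsum fun y => (measurable_env 0 y).mul (hf.comp (measurable_shift y))

theorem envOp_le {f : Environment → ℝ≥0∞} {c : ℝ≥0∞} (hf : ∀ ω, f ω ≤ c) (ω : Environment) :
    envOp f ω ≤ c := by
  calc envOp f ω ≤ ∑' y : ℤ, (ω.1 0 y : ℝ≥0∞) * c :=
        ENNReal.tsum_le_tsum fun y => by gcongr; exact hf _
    _ = c := by rw [ENNReal.tsum_mul_right, tsum_env, one_mul]

theorem envOp_add (f f' : Environment → ℝ≥0∞) (ω : Environment) :
    envOp (fun ω => f ω + f' ω) ω = envOp f ω + envOp f' ω := by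
  simp only [envOp, mul_add, ENNReal.tsum_add]

theorem measurePreserving_shift {P : Measure Environment}
    (hP : MeasurePreserving (shift 1) P P) (z : ℤ) :
    MeasurePreserving (shift z) P P := by
  have hnat : ∀ n : ℕ, MeasurePreserving (shift n) P P := by
    intro n
    induction n with
    | zero =>
      have : shift ((0 : ℕ) : ℤ) = id := funext fun ω => shift_zero ω
      rw [this]
      exact MeasurePreserving.id P
    | succ n ih =>
      have : shift ((n + 1 : ℕ) : ℤ) = shift 1 ∘ shift n := by
        funext ω
        rw [Function.comp_apply, shift_shift]
        congr 1
        push_cast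
        ring
      rw [this]
      exact hP.comp ih
  obtain ⟨n, rfl | rfl⟩ := z.eq_nat_or_neg
  · exact hnat n
  · refine ⟨measurable_shift _, ?_⟩
    conv_lhs => rw [← (hnat n).map_eq]
    rw [Measure.map_map (measurable_shift _) (measurable_shift _)]
    have : shift (-(n : ℤ)) ∘ shift n = id := by
      funext ω
      rw [Function.comp_apply, shift_shift, neg_add_cancel, shift_zero, id]
    rw [this, Measure.map_id]

theorem card_filter_exit_le (m y : ℤ) :
    ((Finset.Ico 0 m).filter fun k => k + y ∉ Finset.Ico 0 m).card ≤ y.natAbs := by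
  have h1 : (Finset.Ico 0 m).filter (fun k => k + y ∉ Finset.Ico 0 m)
      ⊆ if 0 ≤ y then Finset.Ico (m - y) m else Finset.Ico 0 (-y) := by
    intro k hk
    simp only [Finset.mem_filter, Finset.mem_Ico] at hk
    split_ifs with hy <;> simp only [Finset.mem_Ico] <;> omega
  refine (Finset.card_le_card h1).trans ?_
  split_ifs with hy <;> rw [Int.card_Ico] <;> omega

/-- The balance of the flow through `[0, m)`: the Green function is superinvariant, so only the
jumps that leave `[0, m)` contribute to the error. -/
theorem Regular.sum_green_mul_envOp_le (h : Regular ε C g Γ ω) (m : ℤ)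
    {f : Environment → ℝ≥0∞} (hf : ∀ ω, f ω ≤ 1) :
    ∑ k ∈ Finset.Ico 0 m, green ω k * envOp f (RWRE.shift k ω)
      ≤ ∑ k ∈ Finset.Ico 0 m, green ω k * f (RWRE.shift k ω)
        + g * ∑ k ∈ Finset.Ico 0 m, ∑' y : ℤ,
            (if k + y ∉ Finset.Ico 0 m then (ω.1 k y : ℝ≥0∞) else 0) := by
  have h1 : ∀ k ∈ Finset.Ico 0 m, green ω k * envOp f (RWRE.shift k ω)
      ≤ ∑ z ∈ Finset.Ico 0 m, f (RWRE.shift z ω) * (green ω k * (ω.1 k (z - k) : ℝ≥0∞))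
        + g * ∑' y : ℤ, (if k + y ∉ Finset.Ico 0 m then (ω.1 k y : ℝ≥0∞) else 0) := by
    intro k _
    have h2 : ∑ z ∈ Finset.Ico 0 m, f (RWRE.shift z ω) * (green ω k * (ω.1 k (z - k) : ℝ≥0∞))
        = ∑' y : ℤ, if k + y ∈ Finset.Ico 0 m then
            f (RWRE.shift (k + y) ω) * (green ω k * (ω.1 k y : ℝ≥0∞)) else 0 := by
      rw [← (Equiv.subRight k).tsum_eq, tsum_eq_sum (s := Finset.Ico 0 m)]
      · refine Finset.sum_congr rfl fun z hz => ?_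
        simp only [Equiv.subRight_apply, add_sub_cancel]
        rw [if_pos hz]
      · intro z hz
        simp only [Equiv.subRight_apply, add_sub_cancel]
        rw [if_neg hz]
    rw [h2, envOp, ← ENNReal.tsum_mul_left, ← ENNReal.tsum_mul_left, ← ENNReal.tsum_add]
    refine ENNReal.tsum_le_tsum fun y => ?_
    rw [shift_apply, shift_shift, zero_add, add_comm y k]
    by_cases hy : k + y ∈ Finset.Ico 0 m
    · rw [if_pos hy, if_neg (not_not.2 hy), mul_zero, add_zero]
      exact le_of_eq (by ring)
    · rw [if_neg hy, if_pos hy, zero_add]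
      gcongr
      · exact h.green_le k
      · exact mul_le_of_le_one_right' (hf _)
  refine (Finset.sum_le_sum h1).trans ?_
  rw [Finset.sum_add_distrib, ← Finset.mul_sum, Finset.sum_comm]
  gcongr with z _
  rw [← Finset.mul_sum, mul_comm]
  gcongr
  exact (ENNReal.sum_le_tsum _).trans (tsum_green_mul_le ω z)

variable {P : Measure Environment}

/-- The mean number of visits to `0` of walks started one from each of the sites
`0, -1, …, -(m - 1)`. -/
noncomputable def occupation (m : ℕ) (ω : Environment) : ℝ≥0∞ :=
  ∑ k ∈ Finset.Ico (0 : ℤ) m, green (shift (-k) ω) k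

theorem measurable_occupation (m : ℕ) : Measurable (occupation m) :=
  Finset.measurable_sum _ fun k _ => (measurable_green k).comp (measurable_shift (-k))

theorem Regular.occupation_le {ω : Environment} (h : Regular ε C g Γ ω) (m : ℕ) :
    occupation m ω ≤ m * g := by
  calc occupation m ω ≤ ∑ k ∈ Finset.Ico (0 : ℤ) m, (g : ℝ≥0∞) :=
        Finset.sum_le_sum fun k _ => (h.shift (-k)).green_le k
    _ = m * g := by simp

theorem lintegral_occupation_mul (hP : MeasurePreserving (shift 1) P P) (m : ℕ)
    {f : Environment → ℝ≥0∞} (hf : Measurable f) :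
    ∫⁻ ω, occupation m ω * f ω ∂P
      = ∫⁻ ω, ∑ k ∈ Finset.Ico (0 : ℤ) m, green ω k * f (shift k ω) ∂P := by
  have hg : ∀ k : ℤ, Measurable fun ω => green (shift (-k) ω) k := fun k =>
    (measurable_green k).comp (measurable_shift (-k))
  simp_rw [occupation, Finset.sum_mul]
  have hgf : ∀ k : ℤ, Measurable fun ω => green (shift (-k) ω) k * f ω := fun k => (hg k).mul hf
  have hgf' : ∀ k : ℤ, Measurable fun ω => green ω k * f (shift k ω) := fun k =>
    (measurable_green k).mul (hf.comp (measurable_shift k))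
  rw [lintegral_finsetSum _ fun k _ => hgf k, lintegral_finsetSum _ fun k _ => hgf' k]
  refine Finset.sum_congr rfl fun k _ => ?_
  rw [← (measurePreserving_shift hP k).lintegral_comp (hgf k)]
  simp_rw [shift_shift, neg_add_cancel, shift_zero]

/-- By stationarity, the mean number of exit jumps is a sum over the jumps `y` of the number of
sites, at most `|y|`, from which `y` leads out of `[0, m)`. -/
theorem lintegral_exit_le (hP : MeasurePreserving (shift 1) P P) [IsProbabilityMeasure P]
    (hreg : ∀ᵐ ω ∂P, Regular ε C g Γ ω) (m : ℤ) :
    ∫⁻ ω, ∑ k ∈ Finset.Ico 0 m, ∑' y : ℤ,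
      (if k + y ∉ Finset.Ico 0 m then (ω.1 k y : ℝ≥0∞) else 0) ∂P ≤ C := by
  have hme : ∀ k y : ℤ, Measurable fun ω : Environment =>
      (if k + y ∉ Finset.Ico 0 m then (ω.1 k y : ℝ≥0∞) else 0) := by
    intro k y
    split_ifs
    · exact measurable_const
    · exact measurable_env k y
  have hst : ∀ k y : ℤ, ∫⁻ ω, (if k + y ∉ Finset.Ico 0 m then (ω.1 k y : ℝ≥0∞) else 0) ∂P
      = (if k + y ∉ Finset.Ico 0 m then 1 else 0) * ∫⁻ ω, (ω.1 0 y : ℝ≥0∞) ∂P := by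
    intro k y
    split_ifs
    · simp
    · rw [one_mul, ← (measurePreserving_shift hP k).lintegral_comp (measurable_env 0 y)]
      simp_rw [shift_apply, zero_add]
  rw [lintegral_finsetSum _ fun k _ => Measurable.tsum fun y => hme k y]
  simp_rw [lintegral_tsum fun y => (hme _ y).aemeasurable, hst]
  rw [← Summable.tsum_finsetSum fun _ _ => ENNReal.summable]
  simp_rw [← Finset.sum_mul]
  calc ∑' y : ℤ, (∑ k ∈ Finset.Ico 0 m, if k + y ∉ Finset.Ico 0 m then (1 : ℝ≥0∞) else 0)
        * ∫⁻ ω, (ω.1 0 y : ℝ≥0∞) ∂P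
      ≤ ∑' y : ℤ, (y.natAbs : ℝ≥0∞) * ∫⁻ ω, (ω.1 0 y : ℝ≥0∞) ∂P := by
        refine ENNReal.tsum_le_tsum fun y => ?_
        gcongr
        rw [Finset.sum_boole]
        exact_mod_cast card_filter_exit_le m y
    _ = ∫⁻ ω, ∑' y : ℤ, (y.natAbs : ℝ≥0∞) * (ω.1 0 y : ℝ≥0∞) ∂P := by
        rw [lintegral_tsum fun y => ((measurable_env 0 y).const_mul _).aemeasurable]
        exact tsum_congr fun y => (lintegral_const_mul _ (measurable_env 0 y)).symm
    _ ≤ ∫⁻ _, (C : ℝ≥0∞) ∂P := lintegral_mono_ae (hreg.mono fun ω h => h.mean_jump 0)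
    _ = C := by simp

theorem lintegral_occupation_mul_envOp_le (hP : MeasurePreserving (shift 1) P P)
    [IsProbabilityMeasure P] (hreg : ∀ᵐ ω ∂P, Regular ε C g Γ ω) (m : ℕ)
    {f : Environment → ℝ≥0∞} (hf : Measurable f) (hf1 : ∀ ω, f ω ≤ 1) :
    ∫⁻ ω, occupation m ω * envOp f ω ∂P ≤ ∫⁻ ω, occupation m ω * f ω ∂P + g * C := by
  rw [lintegral_occupation_mul hP m (measurable_envOp hf), lintegral_occupation_mul hP m hf]
  refine (lintegral_mono_ae (hreg.mono fun ω h => h.sum_green_mul_envOp_le m hf1)).trans ?_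
  rw [lintegral_add_left, lintegral_const_mul' _ _ ENNReal.coe_ne_top]
  · gcongr
    exact lintegral_exit_le hP hreg m
  · exact Finset.measurable_sum _ fun k _ =>
      (measurable_green k).mul (hf.comp (measurable_shift k))

theorem le_lintegral_occupation (hP : MeasurePreserving (shift 1) P P)
    [IsProbabilityMeasure P] (hreg : ∀ᵐ ω ∂P, Regular ε C g Γ ω) (N m : ℕ) (hm : m ≠ 0) :
    (N : ℝ≥0∞) ≤ ∫⁻ ω, occupation m ω ∂P + Γ + N * (N * C / m) := by
  have h1 := lintegral_occupation_mul hP m (measurable_const (a := (1 : ℝ≥0∞)))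
  simp only [mul_one] at h1
  rw [h1]
  calc (N : ℝ≥0∞) = ∫⁻ _, N ∂P := by simp
    _ ≤ ∫⁻ ω, ∑ k ∈ Finset.Ico (0 : ℤ) m, green ω k + (Γ + N * (N * C / m)) ∂P := by
        refine lintegral_mono_ae (hreg.mono fun ω h => ?_)
        rw [← add_assoc]
        exact h.le_sum_green N m hm
    _ = _ := by
        rw [lintegral_add_right _ measurable_const]
        simp [add_assoc]

/-- If the transition operator decreases the integrals of all `[0, 1]`-valued functions, then it
preserves them: apply the inequality to `1 - f`. -/
theorem lintegral_envOp_eq_of_le {Q : Measure Environment} [IsFiniteMeasure Q]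
    (h : ∀ f, Measurable f → (∀ ω, f ω ≤ 1) → ∫⁻ ω, envOp f ω ∂Q ≤ ∫⁻ ω, f ω ∂Q)
    {f : Environment → ℝ≥0∞} (hf : Measurable f) (hf1 : ∀ ω, f ω ≤ 1) :
    ∫⁻ ω, envOp f ω ∂Q = ∫⁻ ω, f ω ∂Q := by
  refine le_antisymm (h f hf hf1) ?_
  have hf' : Measurable fun ω => 1 - f ω := measurable_const.sub hf
  have h1 := h _ hf' fun ω => tsub_le_self
  have h2 : ∫⁻ ω, f ω ∂Q + ∫⁻ ω, (1 - f ω) ∂Q = Q Set.univ := by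
    rw [← lintegral_add_left hf, ← lintegral_one]
    simp_rw [add_tsub_cancel_of_le (hf1 _)]
  have h3 : ∫⁻ ω, envOp f ω ∂Q + ∫⁻ ω, envOp (fun ω => 1 - f ω) ω ∂Q = Q Set.univ := by
    rw [← lintegral_add_left (measurable_envOp hf), ← lintegral_one]
    simp_rw [← envOp_add, add_tsub_cancel_of_le (hf1 _)]
    simp [envOp, tsum_env]
  have hfin : ∫⁻ ω, (1 - f ω) ∂Q ≠ ∞ := by
    refine ne_top_of_le_ne_top (measure_ne_top Q Set.univ) ?_
    rw [← h2]
    exact le_add_self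
  refine (ENNReal.add_le_add_iff_right hfin).1 ?_
  rw [h2, ← h3]
  gcongr

/-- The environment viewed from the walker has an invariant probability measure that is absolutely
continuous with respect to `P`. Its density is a weak limit of the normalized mean numbers of
visits to `0` of walks from `0, -1, …, -(m - 1)`. -/
theorem exists_invariant (hP : MeasurePreserving (shift 1) P P) [IsProbabilityMeasure P]
    (hC : C ≠ 0) (hreg : ∀ᵐ ω ∂P, Regular ε C g Γ ω) :
    ∃ Q : Measure Environment, IsProbabilityMeasure Q ∧ Q ≪ P ∧
      ∀ f : Environment → ℝ≥0∞, Measurable f → (∀ ω, f ω ≤ 1) →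
        ∫⁻ ω, envOp f ω ∂Q = ∫⁻ ω, f ω ∂Q := by
  -- With this choice, at each time up to `N + 1` the walk is at distance at least `m N` from its
  -- starting point with probability at most `1 / 2`.
  let m : ℕ → ℕ := fun N => 2 * C * (N + 1)
  have hm0 : ∀ N, m N ≠ 0 := fun N => by positivity
  have hmR : ∀ N, (0 : ℝ) < m N := fun N => by exact_mod_cast Nat.pos_of_ne_zero (hm0 N)
  have hmlim : Tendsto (fun N => (m N : ℝ)) (hyperfilter ℕ : Filter ℕ) atTop := by
    refine Tendsto.mono_left ?_ Nat.hyperfilter_le_atTop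
    refine tendsto_natCast_atTop_atTop.comp (tendsto_atTop_mono (fun N => ?_) tendsto_id)
    have : 1 ≤ C := Nat.one_le_iff_ne_zero.2 hC
    simp only [id, m]
    nlinarith
  let h : ℕ → Environment → ℝ := fun N ω => (occupation (m N) ω).toReal / m N
  have hhm : ∀ N, Measurable (h N) := fun N =>
    (measurable_occupation _).ennreal_toReal.div_const _
  have hh0 : ∀ N ω, 0 ≤ h N ω := fun N ω => by positivity
  have hhg : ∀ N, ∀ᵐ ω ∂P, |h N ω| ≤ g := by
    intro N
    filter_upwards [hreg] with ω hω
    rw [abs_of_nonneg (hh0 N ω), div_le_iff₀ (hmR N), mul_comm]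
    exact ENNReal.toReal_le_of_le_ofReal (by positivity) ((hω.occupation_le (m N)).trans_eq (by
      rw [ENNReal.ofReal_mul (by positivity), ENNReal.ofReal_natCast, ENNReal.ofReal_coe_nnreal]))
  obtain ⟨H, hHi, hH⟩ := exists_weak_limit P h hhm g hhg
  have hH' : ∀ f : Environment → ℝ≥0∞, Measurable f → (∀ ω, f ω ≤ 1) →
      Tendsto (fun N => ∫ ω, h N ω * (f ω).toReal ∂P) (hyperfilter ℕ : Filter ℕ)
        (𝓝 (∫ ω, H ω * (f ω).toReal ∂P)) := fun f hf hf1 =>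
    hH _ hf.ennreal_toReal ⟨1, fun ω => by
      rw [abs_of_nonneg ENNReal.toReal_nonneg]
      exact ENNReal.toReal_le_of_le_ofReal zero_le_one (by simpa using hf1 ω)⟩
  have hfin : ∀ N, ∀ f : Environment → ℝ≥0∞, (∀ ω, f ω ≤ 1) →
      ∫⁻ ω, occupation (m N) ω * f ω ∂P ≠ ∞ := by
    intro N f hf1
    refine ne_top_of_le_ne_top (b := ∫⁻ _, (m N * g : ℝ≥0∞) ∂P) ?_
      (lintegral_mono_ae (hreg.mono fun ω hω => ?_))
    · rw [lintegral_const, measure_univ, mul_one]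
      exact ENNReal.mul_ne_top (ENNReal.natCast_ne_top _) ENNReal.coe_ne_top
    · exact (mul_le_of_le_one_right' (hf1 ω)).trans (hω.occupation_le _)
  have hint : ∀ N, ∀ f : Environment → ℝ≥0∞, Measurable f → (∀ ω, f ω ≤ 1) →
      ∫ ω, h N ω * (f ω).toReal ∂P
        = (∫⁻ ω, occupation (m N) ω * f ω ∂P).toReal / m N := by
    intro N f hf hf1
    have hm1 : Measurable fun ω => occupation (m N) ω * f ω := (measurable_occupation _).mul hf
    rw [← integral_toReal hm1.aemeasurable (ae_lt_top hm1 (hfin N f hf1)), ← integral_div]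
    refine integral_congr_ae (ae_of_all _ fun ω => ?_)
    simp only [h, ENNReal.toReal_mul]
    ring
  have hHnonneg : 0 ≤ᵐ[P] H := by
    refine ae_nonneg_of_forall_setIntegral_nonneg hHi fun s hs _ => ?_
    have h1 := hH' (s.indicator 1) (measurable_one.indicator hs) fun ω =>
      Set.indicator_le_self' (fun _ _ => zero_le) ω
    have h2 : ∫ ω, H ω * (s.indicator (1 : Environment → ℝ≥0∞) ω).toReal ∂P
        = ∫ ω in s, H ω ∂P := by
      rw [← integral_indicator hs]
      refine integral_congr_ae (ae_of_all _ fun ω => ?_)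
      by_cases hω : ω ∈ s <;> simp [hω]
    rw [← h2]
    exact ge_of_tendsto' h1 fun N => integral_nonneg fun ω =>
      mul_nonneg (hh0 N ω) ENNReal.toReal_nonneg
  have hHsub : ∀ f : Environment → ℝ≥0∞, Measurable f → (∀ ω, f ω ≤ 1) →
      ∫ ω, H ω * (envOp f ω).toReal ∂P ≤ ∫ ω, H ω * (f ω).toReal ∂P := by
    intro f hf hf1
    have hlim : Tendsto (fun N => ∫ ω, h N ω * (f ω).toReal ∂P + (g * C : ℝ) / m N)
        (hyperfilter ℕ : Filter ℕ) (𝓝 (∫ ω, H ω * (f ω).toReal ∂P + 0)) :=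
      (hH' f hf hf1).add (hmlim.const_div_atTop _)
    rw [add_zero] at hlim
    refine le_of_tendsto_of_tendsto' (hH' _ (measurable_envOp hf) (envOp_le hf1)) hlim fun N => ?_
    rw [hint N _ (measurable_envOp hf) (envOp_le hf1), hint N f hf hf1, ← add_div]
    gcongr
    have h1 := ENNReal.toReal_mono
      (ENNReal.add_ne_top.2 ⟨hfin N f hf1, ENNReal.mul_ne_top ENNReal.coe_ne_top
        (ENNReal.natCast_ne_top C)⟩) (lintegral_occupation_mul_envOp_le hP hreg (m N) hf hf1)
    rw [ENNReal.toReal_add (hfin N f hf1) (ENNReal.mul_ne_top ENNReal.coe_ne_top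
        (ENNReal.natCast_ne_top C)), ENNReal.toReal_mul] at h1
    simpa using h1
  have hHpos : 0 < ∫ ω, H ω ∂P := by
    have hCR : (0 : ℝ) < C := by exact_mod_cast Nat.pos_of_ne_zero hC
    have h1 := hH' 1 measurable_one fun ω => le_rfl
    simp only [Pi.one_apply, ENNReal.toReal_one, mul_one] at h1
    have hlim : Tendsto (fun N => 1 / (4 * C : ℝ) - Γ / m N)
        (hyperfilter ℕ : Filter ℕ) (𝓝 (1 / (4 * C : ℝ) - 0)) :=
      tendsto_const_nhds.sub (hmlim.const_div_atTop _)
    rw [sub_zero] at hlim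
    refine lt_of_lt_of_le (by positivity) (le_of_tendsto_of_tendsto' hlim h1 fun N => ?_)
    have h2 := hint N 1 measurable_one fun ω => le_rfl
    have h3 := hfin N 1 fun ω => le_rfl
    simp only [Pi.one_apply, ENNReal.toReal_one, mul_one] at h2 h3
    rw [h2]
    have h4 := le_lintegral_occupation hP hreg (N + 1) (m N) (hm0 N)
    have h5 : ((N + 1 : ℕ) : ℝ≥0∞) * C / m N ≠ ∞ := ENNReal.div_ne_top
      (ENNReal.mul_ne_top (ENNReal.natCast_ne_top _) (ENNReal.natCast_ne_top _))
      (by exact_mod_cast hm0 N)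
    have h6 := ENNReal.mul_ne_top (ENNReal.natCast_ne_top (N + 1)) h5
    have h7 := ENNReal.toReal_mono
      (ENNReal.add_ne_top.2 ⟨ENNReal.add_ne_top.2 ⟨h3, ENNReal.coe_ne_top⟩, h6⟩) h4
    rw [ENNReal.toReal_add (ENNReal.add_ne_top.2 ⟨h3, ENNReal.coe_ne_top⟩) h6,
      ENNReal.toReal_add h3 ENNReal.coe_ne_top, ENNReal.toReal_mul, ENNReal.toReal_div,
      ENNReal.toReal_mul] at h7
    simp only [ENNReal.toReal_natCast, ENNReal.coe_toReal] at h7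
    rw [le_div_iff₀ (hmR N), sub_mul, div_mul_cancel₀ _ (hmR N).ne']
    have h8 : (m N : ℝ) = 2 * C * (N + 1 : ℕ) := by simp [m]
    have h9 : ((N + 1 : ℕ) : ℝ) * C / m N = 1 / 2 := by
      rw [h8]
      field_simp
    have h10 : 1 / (4 * C : ℝ) * m N = (N + 1 : ℕ) / 2 := by
      rw [h8]
      field_simp
      norm_num
    rw [h9] at h7
    rw [h10]
    linarith
  let Q : Measure Environment := P.withDensity fun ω => ENNReal.ofReal (H ω)
  have hQ : ∀ f : Environment → ℝ≥0∞, Measurable f → (∀ ω, f ω ≤ 1) →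
      ∫⁻ ω, f ω ∂Q = ENNReal.ofReal (∫ ω, H ω * (f ω).toReal ∂P) := by
    intro f hf hf1
    have hf2 : ∀ ω, ‖(f ω).toReal‖ ≤ 1 := fun ω => by
      rw [Real.norm_of_nonneg ENNReal.toReal_nonneg]
      exact ENNReal.toReal_le_of_le_ofReal zero_le_one (by simpa using hf1 ω)
    rw [lintegral_withDensity_eq_lintegral_mul₀ hHi.aemeasurable.ennreal_ofReal hf.aemeasurable,
      ofReal_integral_eq_lintegral_ofReal]
    · refine lintegral_congr_ae ?_
      filter_upwards [hHnonneg] with ω hω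
      rw [ENNReal.ofReal_mul hω, ENNReal.ofReal_toReal (ne_top_of_le_ne_top (by simp) (hf1 ω))]
      rfl
    · exact hHi.mul_bdd hf.ennreal_toReal.aestronglyMeasurable (ae_of_all _ hf2)
    · filter_upwards [hHnonneg] with ω hω
      exact mul_nonneg hω ENNReal.toReal_nonneg
  have hQu : Q Set.univ = ENNReal.ofReal (∫ ω, H ω ∂P) := by
    have := hQ 1 measurable_one fun ω => le_rfl
    simpa using this
  have : IsFiniteMeasure Q := ⟨by rw [hQu]; exact ENNReal.ofReal_lt_top⟩
  have hQ0 : Q Set.univ ≠ 0 := by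
    rw [hQu]
    exact (ENNReal.ofReal_pos.2 hHpos).ne'
  refine ⟨(Q Set.univ)⁻¹ • Q, ⟨?_⟩, ?_, fun f hf hf1 => ?_⟩
  · rw [Measure.smul_apply, smul_eq_mul, ENNReal.inv_mul_cancel hQ0 (measure_ne_top _ _)]
  · exact (Measure.smul_absolutelyContinuous).trans (withDensity_absolutelyContinuous _ _)
  · rw [lintegral_smul_measure, lintegral_smul_measure]
    congr 1
    refine lintegral_envOp_eq_of_le (fun f hf hf1 => ?_) hf hf1
    rw [hQ f hf hf1, hQ _ (measurable_envOp hf) (envOp_le hf1)]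
    exact ENNReal.ofReal_le_ofReal (hHsub f hf hf1)

/-- An invariant measure that is absolutely continuous with respect to `P` is equivalent to `P`:
by ellipticity the shift preserves its null sets, so that the union of the preimages of a null set
under the iterated shift is a null set that has `P`-probability `0` or `1`. -/
theorem absolutelyContinuous_invariant (hP : Ergodic (shift 1) P) [IsProbabilityMeasure P]
    (hε : 0 < ε) (hreg : ∀ᵐ ω ∂P, Regular ε C g Γ ω) {Q : Measure Environment}
    [IsProbabilityMeasure Q] (hQP : Q ≪ P)
    (hQ : ∀ f : Environment → ℝ≥0∞, Measurable f → (∀ ω, f ω ≤ 1) →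
        ∫⁻ ω, envOp f ω ∂Q = ∫⁻ ω, f ω ∂Q) : P ≪ Q := by
  have hstep : ∀ s, MeasurableSet s → Q s = 0 → Q (shift 1 ⁻¹' s) = 0 := by
    intro s hs h0
    have h1 := hQ (s.indicator 1) (measurable_one.indicator hs) fun ω =>
      Set.indicator_le_self' (fun _ _ => zero_le) ω
    rw [lintegral_indicator_one hs, h0,
      lintegral_eq_zero_iff (measurable_envOp (measurable_one.indicator hs))] at h1
    refine measure_mono_null ?_ (ae_iff.1 (h1.and (hQP.ae_le hreg)))
    rintro ω hω ⟨h2, h3⟩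
    have h4 := ENNReal.tsum_eq_zero.1 h2 1
    have h5 : s.indicator (1 : Environment → ℝ≥0∞) (shift 1 ω) = 1 :=
      Set.indicator_of_mem (s := s) hω _
    rw [h5, mul_one, ENNReal.coe_eq_zero] at h4
    exact absurd (h3.elliptic 0) (not_le.2 (h4 ▸ hε))
  refine Measure.AbsolutelyContinuous.mk fun s hs h0 => ?_
  let A : ℕ → Set Environment := fun n => (shift 1)^[n] ⁻¹' s
  have hA : ∀ n, MeasurableSet (A n) ∧ Q (A n) = 0 := by
    intro n
    induction n with
    | zero => exact ⟨hs, h0⟩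
    | succ n ih =>
      have : A (n + 1) = shift 1 ⁻¹' A n := by
        simp only [A, Function.iterate_succ, Set.preimage_comp]
      rw [this]
      exact ⟨measurable_shift 1 ih.1, hstep _ ih.1 ih.2⟩
  have hU : MeasurableSet (⋃ n, A n) := MeasurableSet.iUnion fun n => (hA n).1
  have hUQ : Q (⋃ n, A n) = 0 := measure_iUnion_null fun n => (hA n).2
  have hinv : shift 1 ⁻¹' (⋃ n, A n) ⊆ ⋃ n, A n := by
    rw [Set.preimage_iUnion]
    refine Set.iUnion_subset fun n => ?_
    refine subset_trans (subset_of_eq ?_) (Set.subset_iUnion A (n + 1))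
    simp only [A, Function.iterate_succ, Set.preimage_comp]
  have hsU : s ⊆ ⋃ n, A n := Set.subset_iUnion A 0
  rcases hP.ae_empty_or_univ_of_preimage_ae_le hU.nullMeasurableSet
    (LE.le.eventuallyLE hinv) with h | h
  · exact measure_mono_null hsU (ae_eq_empty.1 h)
  · exfalso
    have h1 : Q (⋃ n, A n)ᶜ = 0 := hQP (ae_eq_univ.1 h)
    have h2 := measure_univ (μ := Q)
    rw [← Set.union_compl_self (⋃ n, A n)] at h2
    have h3 := measure_union_null hUQ h1
    rw [h3] at h2
    exact zero_ne_one h2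

/-! ### Ergodicity of the environment viewed from the walker -/

/-- One step of the walk, seen from the walker: the environment is moved to the new position and
the first jump is forgotten. -/
def stepMap (p : Environment × (ℕ → ℤ)) : Environment × (ℕ → ℤ) :=
  (shift (p.2 0) p.1, fun n => p.2 (n + 1))

theorem measurable_stepMap : Measurable stepMap := by
  refine Measurable.prodMk ?_ (by fun_prop)
  have h1 : Measurable fun q : Environment × ℤ => shift q.2 q.1 :=
    measurable_from_prod_countable_left fun z => measurable_shift z
  exact h1.comp (measurable_fst.prodMk ((measurable_pi_apply 0).comp measurable_snd))

theorem iterate_stepMap_apply_zero (p : Environment × (ℕ → ℤ)) (n : ℕ) :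
    (stepMap^[n] p).2 0 = p.2 n := by
  induction n generalizing p with
  | zero => rfl
  | succ n ih => rw [Function.iterate_succ_apply, ih]; rfl

/-- The law of the jumps, as a kernel from the environments. -/
noncomputable def jumpsKernel : Kernel Environment (ℕ → ℤ) := ⟨jumpsLaw, measurable_jumpsLaw⟩

instance : IsMarkovKernel jumpsKernel :=
  ⟨fun ω => inferInstanceAs (IsProbabilityMeasure (jumpsLaw ω))⟩

/-- The probability, under the quenched law in the environment `ω`, of the section at `ω` of the
event `s`. -/
noncomputable def sectionProb (s : Set (Environment × (ℕ → ℤ))) (ω : Environment) : ℝ≥0∞ :=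
  jumpsLaw ω (Prod.mk ω ⁻¹' s)

theorem measurable_sectionProb {s : Set (Environment × (ℕ → ℤ))} (hs : MeasurableSet s) :
    Measurable (sectionProb s) :=
  Kernel.measurable_kernel_prodMk_left (κ := jumpsKernel) hs

theorem sectionProb_le_one (s : Set (Environment × (ℕ → ℤ))) (ω : Environment) :
    sectionProb s ω ≤ 1 := prob_le_one

theorem compProd_jumpsKernel_apply (Q : Measure Environment) [IsProbabilityMeasure Q]
    {s : Set (Environment × (ℕ → ℤ))} (hs : MeasurableSet s) :
    (Q ⊗ₘ jumpsKernel) s = ∫⁻ ω, sectionProb s ω ∂Q :=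
  Measure.compProd_apply hs

theorem sectionProb_preimage {s : Set (Environment × (ℕ → ℤ))} (hs : MeasurableSet s)
    (ω : Environment) : sectionProb (stepMap ⁻¹' s) ω = envOp (sectionProb s) ω :=
  jumpsLaw_apply ω (measurable_prodMk_left (measurable_stepMap hs))

theorem measurePreserving_stepMap {Q : Measure Environment} [IsProbabilityMeasure Q]
    (hQ : ∀ f : Environment → ℝ≥0∞, Measurable f → (∀ ω, f ω ≤ 1) →
        ∫⁻ ω, envOp f ω ∂Q = ∫⁻ ω, f ω ∂Q) :
    MeasurePreserving stepMap (Q ⊗ₘ jumpsKernel) (Q ⊗ₘ jumpsKernel) := by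
  refine ⟨measurable_stepMap, Measure.ext fun s hs => ?_⟩
  rw [Measure.map_apply measurable_stepMap hs,
    compProd_jumpsKernel_apply Q (measurable_stepMap hs), compProd_jumpsKernel_apply Q hs,
    ← hQ _ (measurable_sectionProb hs) (sectionProb_le_one s)]
  simp_rw [sectionProb_preimage hs]

variable {Q : Measure Environment}

/-- A harmonic function of the environment viewed from the walker is constant. For each `r` the
function `min u r` is superharmonic, hence harmonic by invariance of `Q`. So `u` cannot drop below
`r` by a jump from a point where it is above `r`, in particular not by the jump `1`; and a function
that increases along an ergodic transformation is constant. -/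
theorem harmonic_ae_const (hP : Ergodic (shift 1) P) [IsProbabilityMeasure P]
    (hε : 0 < ε) (hreg : ∀ᵐ ω ∂P, Regular ε C g Γ ω) [IsProbabilityMeasure Q] (hPQ : P ≪ Q)
    (hQ : ∀ f : Environment → ℝ≥0∞, Measurable f → (∀ ω, f ω ≤ 1) →
        ∫⁻ ω, envOp f ω ∂Q = ∫⁻ ω, f ω ∂Q)
    {u : Environment → ℝ≥0∞} (hu : Measurable u) (hu1 : ∀ ω, u ω ≤ 1)
    (hharm : ∀ ω, envOp u ω = u ω) : ∃ c, ∀ᵐ ω ∂P, u ω = c := by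
  have hmin : ∀ r : ℚ, ∀ᵐ ω ∂P, envOp (fun ω => min (u ω) (ENNReal.ofReal r)) ω
      = min (u ω) (ENNReal.ofReal r) := by
    intro r
    have hm : Measurable fun ω => min (u ω) (ENNReal.ofReal r) := hu.min measurable_const
    have hm1 : ∀ ω, min (u ω) (ENNReal.ofReal r) ≤ 1 := fun ω => (min_le_left _ _).trans (hu1 ω)
    refine hPQ.ae_le (ae_eq_of_ae_le_of_lintegral_le (ae_of_all _ fun ω => le_min ?_ ?_) ?_
      hm.aemeasurable (hQ _ hm hm1).ge)
    · rw [← hharm ω]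
      exact ENNReal.tsum_le_tsum fun y => by gcongr; exact min_le_left _ _
    · exact envOp_le (fun ω => min_le_right _ _) ω
    · rw [hQ _ hm hm1]
      refine ne_top_of_le_ne_top ENNReal.one_ne_top ((lintegral_mono hm1).trans ?_)
      simp
  have hle : ∀ᵐ ω ∂P, u ω ≤ u (shift 1 ω) := by
    filter_upwards [ae_all_iff.2 hmin, hreg] with ω h1 h2
    by_contra! hlt
    obtain ⟨r, -, hr1, hr2⟩ := ENNReal.lt_iff_exists_rat_btwn.1 hlt
    have h3 := h1 r
    have h3' : min (u ω) (ENNReal.ofReal r) = ENNReal.ofReal r := min_eq_right hr2.le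
    rw [h3'] at h3
    refine absurd h3 (ne_of_lt ?_)
    calc envOp (fun ω => min (u ω) (ENNReal.ofReal r)) ω
        < ∑' y : ℤ, (ω.1 0 y : ℝ≥0∞) * ENNReal.ofReal r := by
          refine ENNReal.tsum_lt_tsum (i := 1) ?_ (fun y => ?_) ?_
          · exact ne_top_of_le_ne_top ENNReal.one_ne_top
              (envOp_le (f := fun ω => min (u ω) (ENNReal.ofReal r))
                (fun ω => (min_le_left _ _).trans (hu1 ω)) ω)
          · gcongr
            exact min_le_right _ _
          · refine ENNReal.mul_lt_mul_right ?_ ENNReal.coe_ne_top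
              ((min_le_left _ _).trans_lt hr1)
            exact_mod_cast (hε.trans_le (h2.elliptic 0)).ne'
      _ = ENNReal.ofReal r := by rw [ENNReal.tsum_mul_right, tsum_env, one_mul]
  have heq : u =ᵐ[P] u ∘ shift 1 := by
    refine ae_eq_of_ae_le_of_lintegral_le hle ?_ (hu.comp (measurable_shift 1)).aemeasurable ?_
    · refine ne_top_of_le_ne_top ENNReal.one_ne_top ((lintegral_mono hu1).trans ?_)
      simp
    · exact (hP.toMeasurePreserving.lintegral_comp hu).le
  exact hP.ae_eq_const_of_ae_eq_comp₀ hu.nullMeasurable heq.symm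

theorem ae_forall_shift (hP : MeasurePreserving (shift 1) P P) {p : Environment → Prop}
    (h : ∀ᵐ ω ∂P, p ω) : ∀ᵐ ω ∂P, ∀ x, p (shift x ω) :=
  ae_all_iff.2 fun x => (measurePreserving_shift hP x).quasiMeasurePreserving.ae h

/-- If an invariant event has the same probability for the walks from all sites, then by the Markov
property it is independent of the first `n` jumps. -/
theorem jumpsLaw_cyl_inter {s : Set (Environment × (ℕ → ℤ))} (hs : MeasurableSet s)
    (hinv : stepMap ⁻¹' s = s) {c : ℝ≥0∞} (n : ℕ) (a : ℕ → ℤ) (ω : Environment)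
    (hω : ∀ x, sectionProb s (shift x ω) = c) :
    jumpsLaw ω (cyl n a ∩ Prod.mk ω ⁻¹' s) = c * jumpsLaw ω (cyl n a) := by
  induction n generalizing a ω with
  | zero =>
    rw [cyl_zero, Set.univ_inter, measure_univ, mul_one]
    have h1 := hω 0
    rwa [shift_zero, sectionProb] at h1
  | succ n ih =>
    rw [jumpsLaw_apply ω ((measurableSet_cyl _ _).inter (measurable_prodMk_left hs)),
      jumpsLaw_apply ω (measurableSet_cyl _ _), ← ENNReal.tsum_mul_left]
    refine tsum_congr fun y => ?_
    have h1 : consJump y ⁻¹' (Prod.mk ω ⁻¹' s) = Prod.mk (shift y ω) ⁻¹' s := by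
      conv_lhs => rw [← hinv]
      rfl
    rw [Set.preimage_inter, h1]
    by_cases hy : y = a 0
    · rw [hy, consJump_preimage_cyl, ih]
      · ring
      · intro x
        rw [shift_shift]
        exact hω _
    · simp [consJump_preimage_cyl_of_ne hy]

/-- The walk seen from the walker is ergodic: by `harmonic_ae_const` an invariant event has
a constant quenched probability, so by `jumpsLaw_cyl_inter` it is independent of itself. -/
theorem ergodic_stepMap (hP : Ergodic (shift 1) P) [IsProbabilityMeasure P]
    (hε : 0 < ε) (hreg : ∀ᵐ ω ∂P, Regular ε C g Γ ω) [IsProbabilityMeasure Q] (hQP : Q ≪ P)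
    (hPQ : P ≪ Q)
    (hQ : ∀ f : Environment → ℝ≥0∞, Measurable f → (∀ ω, f ω ≤ 1) →
        ∫⁻ ω, envOp f ω ∂Q = ∫⁻ ω, f ω ∂Q) :
    Ergodic stepMap (Q ⊗ₘ jumpsKernel) := by
  refine ⟨measurePreserving_stepMap hQ, ⟨fun s hs hinv => ?_⟩⟩
  obtain ⟨c, hc⟩ := harmonic_ae_const hP hε hreg hPQ hQ (measurable_sectionProb hs)
    (sectionProb_le_one s) fun ω => by rw [← sectionProb_preimage hs, hinv]
  have hcc : c = c * c := by
    obtain ⟨ω, hω⟩ := (ae_forall_shift hP.toMeasurePreserving hc).exists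
    have hsω : MeasurableSet (Prod.mk ω ⁻¹' s) := measurable_prodMk_left hs
    have h1 : (jumpsLaw ω).restrict (Prod.mk ω ⁻¹' s) = c • jumpsLaw ω := by
      refine ext_of_cyl fun n a => ?_
      rw [Measure.restrict_apply (measurableSet_cyl n a), jumpsLaw_cyl_inter hs hinv n a ω hω,
        Measure.smul_apply, smul_eq_mul]
    have h2 := congrArg (fun μ => μ (Prod.mk ω ⁻¹' s)) h1
    have h3 := hω 0
    rw [shift_zero, sectionProb] at h3
    simpa [Measure.restrict_apply hsω, h3] using h2
  have hQc : (Q ⊗ₘ jumpsKernel) s = c := by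
    rw [compProd_jumpsKernel_apply Q hs, lintegral_congr_ae (hQP.ae_le hc)]
    simp
  rw [Filter.eventuallyConst_set']
  have hc1 : c ≤ 1 := hQc ▸ prob_le_one
  by_cases hc0 : c = 0
  · left
    exact ae_eq_empty.2 (hQc.trans hc0)
  · right
    have h1 : c = 1 := by
      have h2 : c * 1 = c * c := by rw [mul_one]; exact hcc
      exact ((ENNReal.mul_right_inj hc0 (ne_top_of_le_ne_top ENNReal.one_ne_top hc1)).1 h2).symm
    refine ae_eq_univ.2 ((prob_compl_eq_zero_iff hs).2 (hQc.trans h1))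

/-! ### The law of large numbers in an ergodic regular environment -/

theorem exists_tendsto_walk_div (hP : Ergodic (shift 1) P) [IsProbabilityMeasure P]
    (hε : 0 < ε) (hC : C ≠ 0) (hreg : ∀ᵐ ω ∂P, Regular ε C g Γ ω) :
    ∃ v : ℝ, ∀ᵐ ω ∂P, ∀ᵐ ξ ∂jumpsLaw ω,
      Tendsto (fun n : ℕ => (walk ξ n : ℝ) / n) atTop (𝓝 v) := by
  obtain ⟨Q, hQ1, hQP, hQ⟩ := exists_invariant hP.toMeasurePreserving hC hreg
  have hPQ := absolutelyContinuous_invariant hP hε hreg hQP hQ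
  have herg := ergodic_stepMap hP hε hreg hQP hPQ hQ
  let f : Environment × (ℕ → ℤ) → ℝ := fun p => (p.2 0 : ℝ)
  have hf : Measurable f :=
    (measurable_of_countable fun z : ℤ => (z : ℝ)).comp
      ((measurable_pi_apply 0).comp measurable_snd)
  have hfi : Integrable f (Q ⊗ₘ jumpsKernel) := by
    refine ⟨hf.aestronglyMeasurable, ?_⟩
    rw [HasFiniteIntegral, Measure.lintegral_compProd hf.enorm]
    refine lt_of_le_of_lt (b := (C : ℝ≥0∞)) ?_ (ENNReal.natCast_lt_top C)
    calc ∫⁻ ω, ∫⁻ ξ, ‖f (ω, ξ)‖ₑ ∂jumpsKernel ω ∂Q ≤ ∫⁻ _, (C : ℝ≥0∞) ∂Q := by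
          have hregQ : ∀ᵐ ω ∂Q, Regular ε C g Γ ω := hQP.ae_le hreg
          refine lintegral_mono_ae (hregQ.mono fun ω hω => ?_)
          refine le_trans (le_of_eq ?_) ((hω.lintegral_walk_le 1).trans_eq (by simp))
          refine lintegral_congr fun ξ => ?_
          simp only [f, walk, Finset.range_one, Finset.sum_singleton]
          rw [← ofReal_norm, Real.norm_eq_abs, ← Int.cast_abs, Int.abs_eq_natAbs,
            Int.cast_natCast, ENNReal.ofReal_natCast]
      _ = C := by simp
  refine ⟨∫ p, f p ∂(Q ⊗ₘ jumpsKernel), ?_⟩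
  have h1 := Measure.ae_ae_of_ae_compProd (ae_tendsto_birkhoffAverage herg hf hfi)
  filter_upwards [hPQ.ae_le h1] with ω hω
  refine Eventually.mono (f := ae (jumpsLaw ω)) hω fun ξ hξ => hξ.congr fun n => ?_
  rw [birkhoffAverage, birkhoffSum, smul_eq_mul, div_eq_inv_mul, walk, Int.cast_sum]
  congr 1
  exact Finset.sum_congr rfl fun k _ => by simp only [f, iterate_stepMap_apply_zero]

/-- A walk of speed at most `0` would stay below `n / D` up to time `n` for every `D`, but its mean
time below `n / D` is at most of order `g * n / D`. -/
theorem Regular.speed_pos {ω : Environment} (h : Regular ε C g Γ ω) {v : ℝ}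
    (hv : ∀ᵐ ξ ∂jumpsLaw ω, Tendsto (fun n : ℕ => (walk ξ n : ℝ) / n) atTop (𝓝 v)) : 0 < v := by
  by_contra! hv0
  -- With probability at least `1 / 2` the walk is below `M` at a late time before `D * M`, and it
  -- spends a mean time of at most `(M + 1) * g + Γ` there: a contradiction if `D / 2 > g`.
  obtain ⟨D, hD⟩ := exists_nat_ge (2 * (g : ℝ) + 2)
  have hD0 : (0 : ℝ) < D := lt_of_lt_of_le (by positivity) hD
  let A : ℕ → Set (ℕ → ℤ) := fun n => {ξ | (D : ℤ) * walk ξ n ≤ n}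
  have hAm : ∀ n, MeasurableSet (A n) := fun n =>
    measurableSet_le ((measurable_walk n).const_mul _) measurable_const
  have hlim : Tendsto (fun n => jumpsLaw ω (A n)) atTop (𝓝 (jumpsLaw ω Set.univ)) := by
    refine tendsto_measure_of_ae_tendsto_indicator_of_isFiniteMeasure atTop
      MeasurableSet.univ hAm ?_
    filter_upwards [hv] with ξ hξ
    filter_upwards [hξ.eventually_lt_const (lt_of_le_of_lt hv0 (one_div_pos.2 hD0)),
      eventually_gt_atTop 0] with n hn hn0
    simp only [Set.mem_univ, iff_true]
    have hn0' : (0 : ℝ) < n := by exact_mod_cast hn0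
    rw [div_lt_div_iff₀ hn0' hD0] at hn
    have : (D : ℝ) * walk ξ n ≤ n := by linarith
    exact_mod_cast this
  rw [measure_univ] at hlim
  obtain ⟨n₀, hn₀⟩ := eventually_atTop.1 (hlim.eventually_const_lt
    (show (2 : ℝ≥0∞)⁻¹ < 1 from ENNReal.inv_lt_one.2 (by norm_num)))
  have hcount : ∀ M : ℕ, ((D * M : ℕ) : ℝ≥0∞) * 2⁻¹ ≤ n₀ * 2⁻¹ + ((M + 1 : ℕ) * g + Γ) := by
    intro M
    have h1 : ∀ n ∈ Finset.range (D * M), (2 : ℝ≥0∞)⁻¹ ≤ (if n < n₀ then 2⁻¹ else 0)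
        + (∑ k ∈ Finset.Ico (0 : ℤ) (M + 1 : ℕ), reach ω n k + ∑' k : ℕ, reach ω n (-k)) := by
      intro n hn
      split_ifs with hnn
      · exact le_self_add
      rw [zero_add, ← jumpsLaw_walk_mem]
      refine (hn₀ n (not_lt.1 hnn)).le.trans ((measure_mono (t := {ξ | walk ξ n ∈
        Finset.Ico (0 : ℤ) (M + 1 : ℕ)} ∪ {ξ | walk ξ n ≤ 0}) fun ξ
        (hξ : (D : ℤ) * walk ξ n ≤ n) => ?_).trans
        ((measure_union_le _ _).trans (add_le_add le_rfl (jumpsLaw_walk_nonpos_le ω n))))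
      have hn' : (n : ℤ) < D * M := by exact_mod_cast Finset.mem_range.1 hn
      have hD1 : (0 : ℤ) < D := by exact_mod_cast hD0
      have h2 : walk ξ n < M := lt_of_mul_lt_mul_left (hξ.trans_lt hn') hD1.le
      simp only [Set.mem_union, Set.mem_ofPred_eq, Finset.mem_Ico]
      push_cast
      omega
    have h2 := Finset.sum_le_sum h1
    rw [Finset.sum_const, Finset.card_range, nsmul_eq_mul] at h2
    refine h2.trans ?_
    rw [Finset.sum_add_distrib, Finset.sum_add_distrib, Finset.sum_comm,
      ← Summable.tsum_finsetSum fun _ _ => ENNReal.summable]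
    gcongr
    · rw [← Finset.sum_filter, Finset.sum_const, nsmul_eq_mul]
      gcongr
      refine (Finset.card_le_card (t := Finset.range n₀) fun n hn => ?_).trans_eq
        (Finset.card_range n₀)
      exact Finset.mem_range.2 (Finset.mem_filter.1 hn).2
    · calc ∑ k ∈ Finset.Ico (0 : ℤ) (M + 1 : ℕ), ∑ n ∈ Finset.range (D * M), reach ω n k
          ≤ ∑ k ∈ Finset.Ico (0 : ℤ) (M + 1 : ℕ), (g : ℝ≥0∞) :=
            Finset.sum_le_sum fun k _ => (ENNReal.sum_le_tsum _).trans (h.green_le k)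
        _ = (M + 1 : ℕ) * g := by
            rw [Finset.sum_const, nsmul_eq_mul, Int.card_Ico]
            simp
    · refine (ENNReal.tsum_le_tsum fun k => ENNReal.sum_le_tsum _).trans ?_
      have := h.time_left 0
      rwa [shift_zero] at this
  obtain ⟨M, hM⟩ := exists_nat_gt ((n₀ : ℝ) / 2 + g + Γ)
  have h1 : ((D * M : ℕ) : ℝ≥0) * 2⁻¹ ≤ n₀ * 2⁻¹ + ((M + 1 : ℕ) * g + Γ) := by
    have := hcount M
    rw [show (2 : ℝ≥0∞)⁻¹ = ((2⁻¹ : ℝ≥0) : ℝ≥0∞) by simp] at this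
    exact_mod_cast this
  have h2 : ((D * M : ℕ) : ℝ) * 2⁻¹ ≤ n₀ * 2⁻¹ + ((M + 1 : ℕ) * g + Γ) := by exact_mod_cast h1
  push_cast at h2
  have hM0 : (0 : ℝ) ≤ M := M.cast_nonneg
  nlinarith [mul_le_mul_of_nonneg_right hD hM0]

theorem exists_speed (hP : Ergodic (shift 1) P) [IsProbabilityMeasure P]
    (hε : 0 < ε) (hC : C ≠ 0) (hreg : ∀ᵐ ω ∂P, Regular ε C g Γ ω) :
    ∃ v : ℝ, 0 < v ∧ ∀ᵐ ω ∂P, ∀ᵐ ξ ∂jumpsLaw ω,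
      Tendsto (fun n : ℕ => (walk ξ n : ℝ) / n) atTop (𝓝 v) := by
  obtain ⟨v, hv⟩ := exists_tendsto_walk_div hP hε hC hreg
  obtain ⟨ω, h1, h2⟩ := (hv.and hreg).exists
  exact ⟨v, h2.speed_pos h1, hv⟩

/-! ### Truncated environments -/

theorem trunc_shift (ϱ : ℕ∞) (z : ℤ) (ω : Environment) :
    trunc ϱ (shift z ω) = shift z (trunc ϱ ω) := rfl

theorem trunc_apply_of_lt {ϱ : ℕ∞} {y : ℤ} (hy : (y.natAbs : ℕ∞) < ϱ) (ω : Environment) (x : ℤ) :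
    ω.1 x y ≤ (trunc ϱ ω).1 x y := by
  change ω.1 x y ≤ truncFun ϱ ω x y
  by_cases h0 : y = 0
  · simp [truncFun, h0]
  · simp [truncFun, h0, hy]

theorem trunc_apply_le_of_ne {y : ℤ} (hy : y ≠ 0) (ϱ : ℕ∞) (ω : Environment) (x : ℤ) :
    (trunc ϱ ω).1 x y ≤ ω.1 x y := by
  change truncFun ϱ ω x y ≤ ω.1 x y
  rw [truncFun, if_neg hy]
  split_ifs
  · exact le_rfl
  · exact zero_le

theorem measurable_trunc (ϱ : ℕ∞) : Measurable (trunc ϱ) := by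
  have hω : ∀ x y : ℤ, Measurable fun ω : Environment => ω.1 x y := fun x y =>
    (measurable_pi_apply y).comp ((measurable_pi_apply x).comp measurable_subtype_coe)
  refine Measurable.subtype_mk (f := truncFun ϱ)
    (measurable_pi_iff.2 fun x => measurable_pi_iff.2 fun y => ?_)
  unfold truncFun
  split_ifs
  · exact (hω x 0).add (Measurable.tsum fun z => hω x z)
  · exact hω x y
  · exact measurable_const

theorem ergodic_map_trunc {P : Measure Environment} (hP : Ergodic (shift 1) P) (ϱ : ℕ∞) :
    Ergodic (shift 1) (P.map (trunc ϱ)) :=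
  ((measurable_trunc ϱ).measurePreserving P).ergodic_of_ergodic_semiconj hP
    (measurable_shift 1) (trunc_shift ϱ 1)

/-! ### Removing the truncation from the bound on the Green function -/

/-- The jumps of the paths that lead to `z` in `n` jumps of length less than `ϱ`. -/
def shortPaths (ϱ : ℕ) (n : ℕ) (z : ℤ) : Set (ℕ → ℤ) :=
  {ξ | walk ξ n = z ∧ ∀ i < n, (ξ i).natAbs < ϱ}

theorem measurableSet_shortPaths (ϱ n : ℕ) (z : ℤ) : MeasurableSet (shortPaths ϱ n z) := by
  have : shortPaths ϱ n z
      = {ξ | walk ξ n = z} ∩ ⋂ i < n, {ξ | (ξ i).natAbs < ϱ} := by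
    ext ξ
    simp [shortPaths]
  rw [this]
  refine (measurableSet_walk_eq n z).inter
    (MeasurableSet.biInter (Set.to_countable _) fun i _ => ?_)
  exact (MeasurableSet.of_discrete (s := {k : ℤ | k.natAbs < ϱ})).preimage
    (measurable_pi_apply (X := fun _ : ℕ => ℤ) i)

theorem jumpsLaw_shortPaths_le (ϱ n : ℕ) (z : ℤ) (ω : Environment) :
    jumpsLaw ω (shortPaths ϱ n z) ≤ jumpsLaw (trunc ϱ ω) (shortPaths ϱ n z) := by
  induction n generalizing z ω with
  | zero =>
    by_cases hz : z = 0
    · have : shortPaths ϱ 0 z = Set.univ := by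
        ext
        simp [shortPaths, walk_zero, hz]
      rw [this, measure_univ, measure_univ]
    · have : shortPaths ϱ 0 z = ∅ := by
        ext
        simp [shortPaths, walk_zero, Ne.symm hz]
      rw [this, measure_empty]
      exact zero_le
  | succ n ih =>
    rw [jumpsLaw_apply ω (measurableSet_shortPaths _ _ _),
      jumpsLaw_apply (trunc ϱ ω) (measurableSet_shortPaths _ _ _)]
    refine ENNReal.tsum_le_tsum fun y => ?_
    by_cases hy : y.natAbs < ϱ
    · have h1 : consJump y ⁻¹' shortPaths ϱ (n + 1) z = shortPaths ϱ n (z - y) := by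
        ext ξ
        change (walk (consJump y ξ) (n + 1) = z ∧ ∀ i < n + 1, (consJump y ξ i).natAbs < ϱ)
          ↔ walk ξ n = z - y ∧ ∀ i < n, (ξ i).natAbs < ϱ
        rw [walk_consJump]
        refine and_congr (by omega) ⟨fun h i hi => h (i + 1) (by omega), fun h i hi => ?_⟩
        cases i with
        | zero => exact hy
        | succ i => exact h i (by omega)
      rw [h1, ← trunc_shift]
      exact mul_le_mul' (ENNReal.coe_le_coe.2 (trunc_apply_of_lt (by exact_mod_cast hy) ω 0))
        (ih _ _)
    · have h1 : consJump y ⁻¹' shortPaths ϱ (n + 1) z = ∅ := by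
        ext ξ
        simp only [Set.mem_preimage, Set.mem_empty_iff_false, iff_false]
        exact fun h => hy (h.2 0 n.succ_pos)
      simp [h1]

theorem tendsto_jumpsLaw_shortPaths (n : ℕ) (z : ℤ) (ω : Environment) :
    Tendsto (fun ϱ => jumpsLaw ω (shortPaths ϱ n z)) atTop (𝓝 (reach ω n z)) := by
  have h1 : Monotone fun ϱ => shortPaths ϱ n z := fun ϱ ϱ' h ξ hξ =>
    ⟨hξ.1, fun i hi => (hξ.2 i hi).trans_le h⟩
  have h2 : ⋃ ϱ, shortPaths ϱ n z = {ξ | walk ξ n = z} := by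
    refine Set.Subset.antisymm (Set.iUnion_subset fun ϱ ξ hξ => hξ.1) fun ξ hξ => ?_
    refine Set.mem_iUnion.2 ⟨∑ i ∈ Finset.range n, (ξ i).natAbs + 1, hξ, fun i hi => ?_⟩
    exact Nat.lt_succ_of_le (Finset.single_le_sum (f := fun i => (ξ i).natAbs)
      (fun _ _ => Nat.zero_le _) (Finset.mem_range.2 hi))
  rw [reach, ← h2]
  exact tendsto_measure_iUnion_atTop h1

theorem green_le_of_trunc {ω : Environment} {z : ℤ} {b : ℝ≥0∞} {ϱ₀ : ℕ}
    (h : ∀ ϱ : ℕ, ϱ₀ ≤ ϱ → green (trunc ϱ ω) z ≤ b) : green ω z ≤ b := by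
  rw [green, ENNReal.tsum_eq_iSup_nat]
  refine iSup_le fun N => ?_
  refine le_of_tendsto (tendsto_finsetSum (Finset.range N)
    fun n _ => tendsto_jumpsLaw_shortPaths n z ω) ?_
  filter_upwards [eventually_ge_atTop ϱ₀] with ϱ hϱ
  refine le_trans (Finset.sum_le_sum fun n _ => ?_) ((ENNReal.sum_le_tsum _).trans (h ϱ hϱ))
  exact (jumpsLaw_shortPaths_le ϱ n z ω).trans (measure_mono fun ξ hξ => hξ.1)

theorem walk_jumps (S : ℕ → ℤ) (n : ℕ) : walk (jumps S) n = S n - S 0 :=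
  Finset.sum_range_sub S n

theorem lintegral_visits (ω : Environment) (x : ℤ) :
    ∫⁻ S, visits x S ∂quenchedLaw ω 0 = green ω x := by
  have hm : ∀ k, MeasurableSet {S : ℕ → ℤ | S k = x} := fun k =>
    (measurableSet_singleton x).preimage (measurable_pi_apply (X := fun _ : ℕ => ℤ) k)
  unfold visits green
  rw [lintegral_tsum fun k =>
    (Measurable.ite (hm k) measurable_const measurable_const).aemeasurable]
  refine tsum_congr fun k => ?_
  have h1 : ∫⁻ S : ℕ → ℤ, (if S k = x then 1 else 0) ∂quenchedLaw ω 0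
      = quenchedLaw ω 0 {S | S k = x} := by
    rw [← lintegral_indicator_one (hm k)]
    exact lintegral_congr fun S => by simp [Set.indicator_apply]
  rw [h1, reach, jumpsLaw, Measure.map_apply measurable_jumps (measurableSet_walk_eq k x)]
  refine measure_congr ?_
  filter_upwards [ae_quenchedLaw_zero ω 0] with S hS
  apply propext
  change S k = x ↔ walk (jumps S) k = x
  rw [walk_jumps, hS, sub_zero]

/-! ### The conditions of the theorem -/

/-- The mean jump length is the sum over `s ≥ 1` of the probabilities of a jump of length at least
`s`. -/
theorem ConditionC.exists_mean_jump_le {P : Measure Environment} (hC : ConditionC P) :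
    ∃ C : ℕ, C ≠ 0 ∧
      ∀ᵐ ω ∂P, ∑' y : ℤ, (y.natAbs : ℝ≥0∞) * (ω.1 0 y : ℝ≥0∞) ≤ C := by
  obtain ⟨γ, α, hγ, hα, h⟩ := hC
  let t : ℕ → ℝ := fun s => γ * ((s : ℝ) + 1) ^ (-α)
  have ht0 : ∀ s, 0 ≤ t s := fun s => by positivity
  have hts : Summable t := by
    have h1 : Summable fun s : ℕ => ((s : ℝ)) ^ (-α) := Real.summable_nat_rpow.2 (by linarith)
    have h2 := ((summable_nat_add_iff 1).2 h1).mul_left γ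
    simpa [t] using h2
  obtain ⟨C, hC⟩ := exists_nat_ge (∑' s, t s)
  refine ⟨C + 1, C.succ_ne_zero, ?_⟩
  filter_upwards [ae_all_iff.2 fun s : ℕ => h ((s : ℝ) + 1) (by linarith [s.cast_nonneg (α := ℝ)])]
    with ω hω
  have htail : ∀ s : ℕ, ∑' y : ℤ, (if s < y.natAbs then (ω.1 0 y : ℝ≥0∞) else 0)
      ≤ ENNReal.ofReal (t s) := by
    intro s
    let A : Set ℤ := {y | (s : ℝ) + 1 ≤ |(y : ℝ)|}
    have hA : ∑' y : A, (ω.1 0 y : ℝ) ≤ t s := hω s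
    have h1 : ∑' y : ℤ, (if s < y.natAbs then (ω.1 0 y : ℝ≥0∞) else 0)
        = ∑' y : A, (ω.1 0 y : ℝ≥0∞) := by
      rw [tsum_subtype A fun y => (ω.1 0 y : ℝ≥0∞)]
      refine tsum_congr fun y => ?_
      have h2 : s < y.natAbs ↔ y ∈ A := by
        change _ ↔ (s : ℝ) + 1 ≤ |(y : ℝ)|
        rw [← Int.cast_abs, Int.abs_eq_natAbs, Int.cast_natCast, ← Nat.cast_succ, Nat.cast_le]
        exact Nat.lt_iff_add_one_le
      by_cases hy : s < y.natAbs
      · rw [if_pos hy, Set.indicator_of_mem (h2.1 hy)]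
      · rw [if_neg hy, Set.indicator_of_notMem (mt h2.2 hy)]
    have h3 : Summable fun y : A => ω.1 0 y := NNReal.summable_comp_injective (ω.2 0).summable
      Subtype.val_injective
    rw [h1, ← ENNReal.coe_tsum h3, ← ENNReal.ofReal_coe_nnreal, NNReal.coe_tsum]
    exact ENNReal.ofReal_le_ofReal hA
  have hcount : ∀ y : ℤ, (y.natAbs : ℝ≥0∞) * (ω.1 0 y : ℝ≥0∞)
      = ∑' s : ℕ, if s < y.natAbs then (ω.1 0 y : ℝ≥0∞) else 0 := by
    intro y
    rw [tsum_eq_sum (s := Finset.range y.natAbs) fun s hs => if_neg (mt Finset.mem_range.2 hs),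
      Finset.sum_congr rfl fun s hs => if_pos (Finset.mem_range.1 hs)]
    simp
  simp_rw [hcount]
  rw [ENNReal.tsum_comm]
  calc ∑' s : ℕ, ∑' y : ℤ, (if s < y.natAbs then (ω.1 0 y : ℝ≥0∞) else 0)
      ≤ ∑' s : ℕ, ENNReal.ofReal (t s) := ENNReal.tsum_le_tsum htail
    _ = ENNReal.ofReal (∑' s, t s) := (ENNReal.ofReal_tsum_of_nonneg ht0 hts).symm
    _ ≤ ENNReal.ofReal ((C + 1 : ℕ) : ℝ) := by
        gcongr
        push_cast
        linarith
    _ = (C + 1 : ℕ) := ENNReal.ofReal_natCast _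

theorem measurableSet_regular (ε : ℝ≥0) (C : ℕ) (g Γ : ℝ≥0) :
    MeasurableSet {ω | Regular ε C g Γ ω} := by
  have h1 : {ω | Regular ε C g Γ ω} = ⋂ x : ℤ,
      ({ω : Environment | (ε : ℝ≥0∞) ≤ (ω.1 x 1 : ℝ≥0∞)}
        ∩ {ω : Environment | ∑' y : ℤ, (y.natAbs : ℝ≥0∞) * (ω.1 x y : ℝ≥0∞) ≤ C}
        ∩ {ω : Environment | green (shift x ω) 0 ≤ g}
        ∩ {ω : Environment | ∑' k : ℕ, green (shift x ω) (-k) ≤ Γ}) := by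
    ext ω
    simp only [Set.mem_iInter, Set.mem_inter_iff, Set.mem_ofPred_eq, ENNReal.coe_le_coe]
    exact ⟨fun h x => ⟨⟨⟨h.elliptic x, h.mean_jump x⟩, h.returns x⟩, h.time_left x⟩,
      fun h => ⟨fun x => (h x).1.1.1, fun x => (h x).1.1.2, fun x => (h x).1.2, fun x => (h x).2⟩⟩
  rw [h1]
  refine MeasurableSet.iInter fun x => ?_
  refine (((measurableSet_le measurable_const (measurable_env x 1)).inter
    (measurableSet_le ?_ measurable_const)).inter (measurableSet_le ?_ measurable_const)).inter
    (measurableSet_le ?_ measurable_const)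
  · exact Measurable.tsum fun y => (measurable_env x y).const_mul _
  · exact (measurable_green 0).comp (measurable_shift x)
  · exact Measurable.tsum fun k => (measurable_green _).comp (measurable_shift x)

theorem ConditionD.ae_green_trunc_le {P : Measure Environment} {ϱ₀ : ℕ}
    (hD : ConditionD P ϱ₀) :
    ∃ g : ℕ → ℝ, (∀ k, 0 ≤ g k) ∧ Summable g ∧ ∀ᵐ ω ∂P, ∀ ϱ : ℕ∞, (ϱ₀ : ℕ∞) ≤ ϱ → ∀ k : ℕ,
      green (trunc ϱ ω) (-k) ≤ ENNReal.ofReal (g k) := by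
  obtain ⟨g, hg0, -, hgs, hg⟩ := hD
  refine ⟨g, hg0, ?_, ?_⟩
  · refine (summable_nat_add_iff 1).1 (Summable.of_nonneg_of_le (fun k => hg0 _) (fun k => ?_)
      ((summable_nat_add_iff 1).2 hgs))
    refine le_mul_of_one_le_left (hg0 _) ?_
    push_cast
    linarith [k.cast_nonneg (α := ℝ)]
  · have h1 : ∀ᵐ ω ∂P, ∀ (k : ℕ) (ϱ : ℕ), ϱ₀ ≤ ϱ →
        green (trunc ϱ ω) (-k) ≤ ENNReal.ofReal (g k) := by
      refine ae_all_iff.2 fun k => ae_all_iff.2 fun ϱ => ?_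
      by_cases hϱ : ϱ₀ ≤ ϱ
      · filter_upwards [hg (-k) (by omega) ϱ hϱ] with ω hω _
        rw [lintegral_visits] at hω
        simpa using hω
      · exact ae_of_all _ fun ω h => absurd h hϱ
    filter_upwards [h1] with ω hω ϱ hϱ k
    cases ϱ with
    | top =>
      rw [trunc_top]
      exact green_le_of_trunc (hω k)
    | coe ϱ => exact hω k ϱ (by exact_mod_cast hϱ)

theorem exists_ae_regular_trunc {P : Measure Environment}
    (hP : MeasurePreserving (shift 1) P P) (hE : ConditionE P) (hC : ConditionC P)
    {ϱ₀ : ℕ} (hϱ₀ : 1 < ϱ₀) (hD : ConditionD P ϱ₀) :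
    ∃ (ε : ℝ≥0) (C : ℕ) (g Γ : ℝ≥0), 0 < ε ∧ C ≠ 0 ∧ ∀ ϱ : ℕ∞, (ϱ₀ : ℕ∞) ≤ ϱ →
      ∀ᵐ ω ∂P, Regular ε C g Γ (trunc ϱ ω) := by
  obtain ⟨ε, hε, hE⟩ := hE
  obtain ⟨C, hC0, hC⟩ := hC.exists_mean_jump_le
  obtain ⟨g, hg0, hgs, hg⟩ := hD.ae_green_trunc_le
  refine ⟨ε, C, (g 0).toNNReal, (∑' k, g k).toNNReal, hε, hC0, fun ϱ hϱ => ?_⟩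
  have hϱ1 : ((1 : ℤ).natAbs : ℕ∞) < ϱ := lt_of_lt_of_le (by exact_mod_cast hϱ₀) hϱ
  filter_upwards [ae_forall_shift hP hE, ae_forall_shift hP hC, ae_forall_shift hP hg]
    with ω h1 h2 h3
  refine ⟨fun x => ?_, fun x => ?_, fun x => ?_, fun x => ?_⟩
  · have h := h1 x
    rw [shift_apply, zero_add] at h
    exact h.trans (trunc_apply_of_lt hϱ1 ω x)
  · have h := h2 x
    simp only [shift_apply, zero_add] at h
    refine (ENNReal.tsum_le_tsum fun y => ?_).trans h
    by_cases hy : y = 0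
    · simp [hy]
    · gcongr
      exact trunc_apply_le_of_ne hy ϱ ω x
  · simpa [ENNReal.ofReal, ← trunc_shift] using h3 x ϱ hϱ 0
  · rw [← trunc_shift]
    refine (ENNReal.tsum_le_tsum fun k => h3 x ϱ hϱ k).trans_eq ?_
    exact (ENNReal.ofReal_tsum_of_nonneg hg0 hgs).symm

end RWRE

theorem theorem2p2
    (P : Measure RWRE.Environment) [IsProbabilityMeasure P]
    (hP : Ergodic (RWRE.shift 1) P)
    (hE : RWRE.ConditionE P) (hC : RWRE.ConditionC P)
    (ϱ₀ : ℕ) (hϱ₀ : 1 < ϱ₀) (hD : RWRE.ConditionD P ϱ₀) :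
    ∀ ϱ : ℕ∞, (ϱ₀ : ℕ∞) ≤ ϱ → ∃ v : ℝ, 0 < v ∧
      ∀ᵐ ω ∂P, ∀ᵐ S ∂(RWRE.quenchedLaw (RWRE.trunc ϱ ω) 0),
        Tendsto (fun n : ℕ => (S n : ℝ) / (n : ℝ)) atTop (𝓝 v) := by
  intro ϱ hϱ
  obtain ⟨ε, C, g, Γ, hε, hC0, hreg⟩ :=
    RWRE.exists_ae_regular_trunc hP.toMeasurePreserving hE hC hϱ₀ hD
  have hm := RWRE.measurable_trunc ϱ
  have hprob : IsProbabilityMeasure (P.map (RWRE.trunc ϱ)) :=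
    Measure.isProbabilityMeasure_map hm.aemeasurable
  obtain ⟨v, hv0, hv⟩ := RWRE.exists_speed (RWRE.ergodic_map_trunc hP ϱ) hε hC0
    ((ae_map_iff hm.aemeasurable (RWRE.measurableSet_regular ε C g Γ)).2 (hreg ϱ hϱ))
  refine ⟨v, hv0, ?_⟩
  filter_upwards [ae_of_ae_map hm.aemeasurable hv] with ω hω
  filter_upwards [ae_of_ae_map RWRE.measurable_jumps.aemeasurable hω,
    RWRE.ae_quenchedLaw_zero (RWRE.trunc ϱ ω) 0] with S h1 h2
  simpa only [RWRE.walk_jumps, h2, sub_zero] using h1
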